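/- Let $T>0$ and $H\in(\tfrac12,1)$, let $W=(W_t)_{t\in[0,T]}$ be a standard Brownian motion and $B^H=(B^H_t)_{t\in[0,T]}$ a fractional Brownian motion with Hurst parameter $H$ (a centred Gaussian process with almost surely continuous paths and covariance $\tfrac12(s^{2H}+t^{2H}-|t-s|^{2H})$), independent of $W$, on a common probability space $(\Omega,\mathcal F,\mathbb P)$, and put $X_t=W_t+B^H_t$. For a $C^1$ function $f:\mathbb R\to\mathbb C$ and $t\in[0,T]$ let $\int_0^t f(s)\,dX_s:=f(t)X_t-f(0)X_0-\int_0^t X_s f'(s)\,ds$ (path by path; $X_0=0$ a.s.), and for $\lambda\in\mathbb R$ let $$I_T(X;\lambda)=\Big|\int_0^T e^{i\lambda s}\,dX_s\Big|^2 .$$ For partitions $\pi=\{0=t_0<t_1<\dots<t_n=T\}$ write $|\pi|=\max_i(t_i-t_{i-1})$. Then the quadratic variation $$[X]_T=\lim_{|\pi|\to0}\sum_{i=1}^n(X_{t_i}-X_{t_{i-1}})^2$$ exists as a limit in probability, and there are functions $J_\lambda:\Omega\to\mathbb C$, denoted $J_\lambda=\int_0^T\int_0^t e^{i\lambda(t-s)}\,dX_s\,dX_t$,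 $\lambda\in\mathbb R$, that are pathwise limits of Riemann–Stieltjes sums in the following sense: for every nested sequence of partitions $(\pi_k)$ of $[0,T]$ with $|\pi_k|\to0$, almost surely $$\sum_{t_i\in\pi_k,\,i\ge1}(X_{t_i}-X_{t_{i-1}})^2\to[X]_T\quad\text{and, for all }\lambda\in\mathbb R,\quad \sum_{t_i\in\pi_k,\,i\ge1}\Big(\int_0^{t_{i-1}}e^{i\lambda(t_{i-1}-s)}\,dX_s\Big)(X_{t_i}-X_{t_{i-1}})\to J_\lambda .$$ Moreover, almost surely, for all $\lambda\in\mathbb R$, $$I_T(X;\lambda)=[X]_T+2\,\mathrm{Re}\int_0^T\int_0^t e^{i\lambda(t-s)}\,dX_s\,dX_t .$$ -/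

import Mathlib

open MeasureTheory ProbabilityTheory Filter Topology

noncomputable section

namespace MixedFBM

variable {Ω : Type*} [MeasurableSpace Ω]

/-- `W` is a standard Brownian motion on the time interval `[0, T]` under `P`. Only the values
`W t` with `t ∈ [0, T]` matter. -/
structure IsBrownianOn (W : ℝ → Ω → ℝ) (T : ℝ) (P : Measure Ω) : Prop where
  zero : ∀ᵐ ω ∂P, W 0 ω = 0
  indep_increments : HasIndepIncrements (fun t : Set.Icc (0 : ℝ) T => W t) P
  law_increments : ∀ s t : ℝ, 0 ≤ s → s ≤ t → t ≤ T →
    HasLaw (fun ω => W t ω - W s ω) (gaussianReal 0 (t - s).toNNReal) P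
  cont : ∀ᵐ ω ∂P, ContinuousOn (fun t => W t ω) (Set.Icc 0 T)

/-- `B` is a fractional Brownian motion with Hurst parameter `H` on `[0, T]` under `P`: a centred
Gaussian process with the fractional covariance and almost surely continuous paths. -/
structure IsFractionalBrownianOn (B : ℝ → Ω → ℝ) (H T : ℝ) (P : Measure Ω) : Prop where
  gaussian : IsGaussianProcess (fun t : Set.Icc (0 : ℝ) T => B t) P
  mean : ∀ t ∈ Set.Icc (0 : ℝ) T, ∫ ω, B t ω ∂P = 0
  covariance : ∀ s ∈ Set.Icc (0 : ℝ) T, ∀ t ∈ Set.Icc (0 : ℝ) T,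
    cov[B s, B t; P] = (s ^ (2 * H) + t ^ (2 * H) - |t - s| ^ (2 * H)) / 2
  cont : ∀ᵐ ω ∂P, ContinuousOn (fun t => B t ω) (Set.Icc 0 T)

/-- A finite partition `0 = t 0 < t 1 < ⋯ < t n = T`. The values `t i` with `i > n` are
irrelevant. -/
structure TimePartition (T : ℝ) where
  n : ℕ
  t : ℕ → ℝ
  t_zero : t 0 = 0
  t_last : t n = T
  t_lt : ∀ i < n, t i < t (i + 1)

namespace TimePartition

variable {T : ℝ}

/-- The set of partition points. -/
def points (π : TimePartition T) : Set ℝ := π.t '' Set.Iic π.n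

/-- The mesh `max_i (t (i+1) - t i)`. -/
def mesh (π : TimePartition T) : ℝ := ⨆ i : Fin π.n, (π.t (i + 1) - π.t i)

/-- The filter `|π| → 0` on partitions. -/
def meshToZero (T : ℝ) : Filter (TimePartition T) := comap mesh (𝓝 0)

/-- A nested sequence of partitions whose mesh tends to zero. -/
structure IsNestedSeq (ρ : ℕ → TimePartition T) : Prop where
  nested : ∀ k, (ρ k).points ⊆ (ρ (k + 1)).points
  mesh_tendsto : Tendsto (fun k => (ρ k).mesh) atTop (𝓝 0)

end TimePartition

/-- The realized quadratic variation of the path `x` along `π`. -/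
def quadSum {T : ℝ} (x : ℝ → ℝ) (π : TimePartition T) : ℝ :=
  ∑ i ∈ Finset.range π.n, (x (π.t (i + 1)) - x (π.t i)) ^ 2

/-- `V` is the quadratic variation of `X` at time `T`: the limit in probability of the realized
quadratic variations as the mesh of the partition of `[0, T]` tends to zero. -/
def IsQuadraticVariation (X : ℝ → Ω → ℝ) (T : ℝ) (P : Measure Ω) (V : Ω → ℝ) : Prop :=
  TendstoInMeasure P (fun (π : TimePartition T) ω => quadSum (fun t => X t ω) π)
    (TimePartition.meshToZero T) V

/-- The pathwise integral `∫_0^t f(s) dx(s)` of a smooth function `f` against a continuous path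
`x`, defined by integration by parts. -/
def pathIntegral (f : ℝ → ℂ) (x : ℝ → ℝ) (t : ℝ) : ℂ :=
  f t * x t - f 0 * x 0 - ∫ s in (0 : ℝ)..t, (x s : ℂ) * deriv f s

/-- The periodogram `|∫_0^T e^{iλs} dx(s)|²`. -/
def periodogram (x : ℝ → ℝ) (T lam : ℝ) : ℝ :=
  ‖pathIntegral (fun s => Complex.exp (Complex.I * lam * s)) x T‖ ^ 2

/-- The Riemann–Stieltjes sum along `π` (integrand evaluated at left endpoints) of the iterated
integral `∫_0^T (∫_0^t e^{iλ(t-s)} dx(s)) dx(t)`. -/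
def iteratedSum {T : ℝ} (x : ℝ → ℝ) (lam : ℝ) (π : TimePartition T) : ℂ :=
  ∑ i ∈ Finset.range π.n,
    pathIntegral (fun s => Complex.exp (Complex.I * lam * (π.t i - s))) x (π.t i) *
      ((x (π.t (i + 1)) - x (π.t i) : ℝ) : ℂ)

end MixedFBM

end

/-! The argument separates an identity for one path from the convergence of realized quadratic
variations.

Pathwise part. For a continuous `x` with `x 0 = 0`, integration by parts gives `∫_0^t e^{iλ(t-s)}
dx(s) = x(t) + A(t)`, where `A = driftPart x λ` is `C¹` and solves `A' = iλ(x + A)`. The iterated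
sum therefore splits in two. The sum of `x Δx` equals `(x(T)² - ∑ (Δx)²) / 2`, and the sum of `A Δx`
converges by summation by parts to `A(T) x(T) - ∫ x A'`. Hence the realized quadratic variations are
the only possible obstruction, and once they converge to `V` the limit exists for every `λ` at once
(`tendsto_iteratedSum_of_continuous`). The periodogram is `|x(T) + A(T)|²`, and integrating the
derivative of `|A|²` gives `|A(T)|² = -2 Re ∫ x A'`; expanding the square yields the formula
(`periodogram_eq_of_continuous`).

Probabilistic part. The quadratic variation is the constant `T`. For `W`, the realized variations
along nested partitions behave like a reverse martingale: given the finer sums, the signs of the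
increments are still symmetric and independent, so the cross terms of the coarser sums average to
zero. This gives a maximal inequality (`sq_mul_measureReal_quadSum_le`) which, with the variance
bound `integral_quadSum_sub_sq_le`, proves almost sure convergence. For `B`, Gaussian moments and
dyadic chaining give Hölder paths of some order above `1/2`, so its realized variation vanishes.
Cauchy–Schwarz (`abs_quadSum_add_sub_le`) removes the cross term in `W + B`. For convergence in
probability, without nesting, Chebyshev for `W` and Markov for `B` suffice. -/

noncomputable section

namespace MixedFBM

/-! ### Partitions and realized quadratic variation -/

section Partitions

namespace TimePartition

variable {T : ℝ} (π : TimePartition T)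

lemma t_lt_t {i j : ℕ} (hij : i < j) (hj : j ≤ π.n) : π.t i < π.t j := by
  induction j, hij using Nat.le_induction with
  | base => exact π.t_lt i hj
  | succ k _ ih => exact (ih (by omega)).trans (π.t_lt k hj)

lemma t_le_t {i j : ℕ} (hij : i ≤ j) (hj : j ≤ π.n) : π.t i ≤ π.t j := by
  rcases hij.eq_or_lt with rfl | h
  · exact le_rfl
  · exact (π.t_lt_t h hj).le

lemma t_lt_t_iff {i j : ℕ} (hi : i ≤ π.n) (hj : j ≤ π.n) : π.t i < π.t j ↔ i < j := by
  refine ⟨fun h => ?_, fun h => π.t_lt_t h hj⟩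
  by_contra hc
  exact absurd (π.t_le_t (not_lt.1 hc) hi) (not_le.2 h)

lemma t_le_t_iff {i j : ℕ} (hi : i ≤ π.n) (hj : j ≤ π.n) : π.t i ≤ π.t j ↔ i ≤ j := by
  rw [← not_lt, π.t_lt_t_iff hj hi, not_lt]

lemma t_mem_Icc {i : ℕ} (hi : i ≤ π.n) : π.t i ∈ Set.Icc 0 T := by
  refine ⟨?_, ?_⟩
  · rw [← π.t_zero]; exact π.t_le_t (Nat.zero_le i) hi
  · conv_rhs => rw [← π.t_last]
    exact π.t_le_t hi le_rfl

lemma t_mem_points {i : ℕ} (hi : i ≤ π.n) : π.t i ∈ π.points := ⟨i, hi, rfl⟩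

lemma sub_le_mesh {i : ℕ} (hi : i < π.n) : π.t (i + 1) - π.t i ≤ π.mesh :=
  le_ciSup (f := fun i : Fin π.n => π.t (i + 1) - π.t i) (Set.finite_range _).bddAbove ⟨i, hi⟩

lemma mesh_nonneg : 0 ≤ π.mesh :=
  Real.iSup_nonneg fun i => sub_nonneg.2 (π.t_lt i i.2).le

lemma sum_sub : ∑ i ∈ Finset.range π.n, (π.t (i + 1) - π.t i) = T := by
  rw [Finset.sum_range_sub, π.t_last, π.t_zero, sub_zero]

/-- No point of a partition lies strictly between two consecutive points. -/
lemma le_t_or_t_succ_le {q : ℝ} (hq : q ∈ π.points) {j : ℕ} (hj : j < π.n) :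
    q ≤ π.t j ∨ π.t (j + 1) ≤ q := by
  obtain ⟨i, hi, rfl⟩ := hq
  rcases Nat.lt_or_ge j i with h | h
  · exact Or.inr (π.t_le_t h hi)
  · exact Or.inl (π.t_le_t h hj.le)

lemma sum_range_ite_Ico (f : ℕ → ℝ) {p q n : ℕ} (hpq : p ≤ q) (hq : q ≤ n) :
    ∑ j ∈ Finset.range n, (if p ≤ j ∧ j < q then f (j + 1) - f j else 0) = f q - f p := by
  rw [← Finset.sum_filter, ← Finset.sum_Ico_sub f hpq]
  refine Finset.sum_congr ?_ fun _ _ => rfl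
  ext j
  simp only [Finset.mem_filter, Finset.mem_range, Finset.mem_Ico]
  omega

/-- Telescoping over the intervals of a partition between two of its points. -/
lemma sub_eq_sum_ite (x : ℝ → ℝ) {a b : ℝ} (ha : a ∈ π.points) (hb : b ∈ π.points)
    (hab : a ≤ b) :
    x b - x a = ∑ j ∈ Finset.range π.n,
      if a ≤ π.t j ∧ π.t j < b then x (π.t (j + 1)) - x (π.t j) else 0 := by
  obtain ⟨p, hp, rfl⟩ := ha
  obtain ⟨q, hq, rfl⟩ := hb
  rw [← sum_range_ite_Ico (fun j => x (π.t j)) ((π.t_le_t_iff hp hq).1 hab) hq]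
  refine Finset.sum_congr rfl fun j hj => ?_
  have hj' : j ≤ π.n := (Finset.mem_range.1 hj).le
  simp only [π.t_le_t_iff hp hj', π.t_lt_t_iff hj' hq]

/-- Every time in `[0, T)` lies in exactly one interval of the partition. -/
lemma sum_ite_mem_Ico {s : ℝ} (h0 : 0 ≤ s) (hs : s < T) :
    ∑ i ∈ Finset.range π.n, (if π.t i ≤ s ∧ s < π.t (i + 1) then (1 : ℝ) else 0) = 1 := by
  have key : ∀ i ∈ Finset.range π.n, (if π.t i ≤ s ∧ s < π.t (i + 1) then (1 : ℝ) else 0) =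
      (if s < π.t (i + 1) then 1 else 0) - (if s < π.t i then 1 else 0) := by
    intro i hi
    have := π.t_lt i (Finset.mem_range.1 hi)
    split_ifs <;> grind
  rw [Finset.sum_congr rfl key, Finset.sum_range_sub (fun i => if s < π.t i then (1 : ℝ) else 0),
    π.t_last, π.t_zero, if_pos hs, if_neg (not_lt.2 h0), sub_zero]

lemma IsNestedSeq.points_subset {ρ : ℕ → TimePartition T} (hρ : IsNestedSeq ρ) {k l : ℕ}
    (hkl : k ≤ l) : (ρ k).points ⊆ (ρ l).points :=
  monotone_nat_of_le_succ (f := fun k => (ρ k).points) hρ.nested hkl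

end TimePartition

variable {T : ℝ}

lemma quadSum_nonneg (x : ℝ → ℝ) (π : TimePartition T) : 0 ≤ quadSum x π :=
  Finset.sum_nonneg fun _ _ => sq_nonneg _

lemma quadSum_congr {x y : ℝ → ℝ} (h : Set.EqOn x y (Set.Icc 0 T)) (π : TimePartition T) :
    quadSum x π = quadSum y π := by
  refine Finset.sum_congr rfl fun i hi => ?_
  have hi := Finset.mem_range.1 hi
  rw [h (π.t_mem_Icc hi.le), h (π.t_mem_Icc hi)]

/-- The realized quadratic variations of a sum and of its first summand are close when the second
summand has small realized quadratic variation. -/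
lemma abs_quadSum_add_sub_le (x y : ℝ → ℝ) (π : TimePartition T) :
    |quadSum (fun t => x t + y t) π - quadSum x π| ≤
      2 * √(quadSum x π * quadSum y π) + quadSum y π := by
  have h1 : quadSum (fun t => x t + y t) π - quadSum x π =
      2 * ∑ i ∈ Finset.range π.n, (x (π.t (i + 1)) - x (π.t i)) * (y (π.t (i + 1)) - y (π.t i)) +
        quadSum y π := by
    simp only [quadSum, Finset.mul_sum, ← Finset.sum_sub_distrib, ← Finset.sum_add_distrib]
    exact Finset.sum_congr rfl fun i _ => by ring
  have h2 : |∑ i ∈ Finset.range π.n,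
      (x (π.t (i + 1)) - x (π.t i)) * (y (π.t (i + 1)) - y (π.t i))| ≤
        √(quadSum x π * quadSum y π) :=
    Real.abs_le_sqrt (Finset.sum_mul_sq_le_sq_mul_sq _ _ _)
  rw [h1]
  refine (abs_add_le _ _).trans ?_
  rw [abs_mul, abs_two, abs_of_nonneg (quadSum_nonneg y π)]
  gcongr

lemma abs_quadSum_add_sub_le' (x y : ℝ → ℝ) (π : TimePartition T) (c : ℝ) :
    |quadSum (fun t => x t + y t) π - c| ≤
      |quadSum x π - c| + (2 * √(quadSum x π * quadSum y π) + quadSum y π) := by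
  have := abs_quadSum_add_sub_le x y π
  have h := abs_sub_le (quadSum (fun t => x t + y t) π) (quadSum x π) c
  linarith

end Partitions

/-! ### Pathwise integration by parts and the periodogram identity -/

section Pathwise

variable {T : ℝ}

/-- The smooth part `iλ ∫_0^t e^{iλ(t-s)} x(s) ds` of `∫_0^t e^{iλ(t-s)} dx(s)`. -/
def driftPart (x : ℝ → ℝ) (lam t : ℝ) : ℂ :=
  Complex.I * lam * Complex.exp (Complex.I * lam * t) *
    ∫ s in (0 : ℝ)..t, (x s : ℂ) * Complex.exp (-(Complex.I * lam * s))

/-- The iterated integral `∫_0^T ∫_0^t e^{iλ(t-s)} dx(s) dx(t)` of a path `x` whose quadratic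
variation on `[0, T]` is `V`. -/
def iteratedIntegral (x : ℝ → ℝ) (V T lam : ℝ) : ℂ :=
  ((x T ^ 2 - V) / 2 : ℝ) + (driftPart x lam T * x T -
    ∫ s in (0 : ℝ)..T, (x s : ℂ) * (Complex.I * lam * (x s + driftPart x lam s)))

lemma hasDerivAt_cexp_mul (lam t : ℝ) :
    HasDerivAt (fun s : ℝ => Complex.exp (Complex.I * lam * s))
      (Complex.I * lam * Complex.exp (Complex.I * lam * t)) t := by
  have h : HasDerivAt (fun s : ℝ => Complex.I * lam * (s : ℂ)) (Complex.I * lam) t := by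
    simpa using (Complex.ofRealCLM.hasDerivAt (x := t)).const_mul (Complex.I * (lam : ℂ))
  simpa [mul_comm] using h.cexp

/-- Product rule: differentiating the integral cancels the two exponentials and leaves `iλ x`. Thus
the drift part is differentiable even though `x` is only continuous, which is what makes the sums of
`A Δx` converge. -/
lemma hasDerivAt_driftPart {x : ℝ → ℝ} (hx : Continuous x) (lam t : ℝ) :
    HasDerivAt (driftPart x lam) (Complex.I * lam * (x t + driftPart x lam t)) t := by
  have hc : Continuous fun s : ℝ => (x s : ℂ) * Complex.exp (-(Complex.I * lam * s)) := by
    fun_prop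
  have h2 := intervalIntegral.integral_hasDerivAt_right (hc.intervalIntegrable 0 t)
    hc.stronglyMeasurable.stronglyMeasurableAtFilter hc.continuousAt
  have h := ((hasDerivAt_cexp_mul lam t).const_mul (Complex.I * (lam : ℂ))).mul h2
  refine h.congr_deriv ?_
  have he : Complex.exp (Complex.I * lam * t) * Complex.exp (-(Complex.I * lam * t)) = 1 := by
    rw [← Complex.exp_add]; simp
  simp only [driftPart]
  linear_combination (Complex.I * lam * x t) * he

lemma pathIntegral_cexp_sub (x : ℝ → ℝ) (h0 : x 0 = 0) (lam τ : ℝ) :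
    pathIntegral (fun s => Complex.exp (Complex.I * lam * (τ - s))) x τ =
      x τ + driftPart x lam τ := by
  have hd : ∀ s : ℝ, deriv (fun s : ℝ => Complex.exp (Complex.I * lam * (τ - s))) s =
      -(Complex.I * lam * Complex.exp (Complex.I * lam * τ)) *
        Complex.exp (-(Complex.I * lam * s)) := by
    intro s
    have h1 := (hasDerivAt_cexp_mul (-lam) s).const_mul (Complex.exp (Complex.I * lam * τ))
    have h2 : (fun s : ℝ => Complex.exp (Complex.I * lam * (τ - s))) = fun s : ℝ =>
        Complex.exp (Complex.I * lam * τ) * Complex.exp (Complex.I * (-lam : ℝ) * s) := by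
      ext s
      rw [← Complex.exp_add]
      congr 1
      push_cast
      ring
    rw [h2, h1.deriv]
    have h3 : Complex.I * ((-lam : ℝ) : ℂ) * s = -(Complex.I * lam * s) := by push_cast; ring
    rw [h3]
    push_cast
    ring
  simp only [pathIntegral, hd, h0, driftPart]
  have h4 : ∀ s : ℝ, (x s : ℂ) * (-(Complex.I * lam * Complex.exp (Complex.I * lam * τ)) *
      Complex.exp (-(Complex.I * lam * s))) =
      -(Complex.I * lam * Complex.exp (Complex.I * lam * τ)) *
        ((x s : ℂ) * Complex.exp (-(Complex.I * lam * s))) := fun s => by ring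
  simp only [h4, intervalIntegral.integral_const_mul]
  simp

/-- Since `x` is real, conjugation turns `e^{iλs}` into `e^{-iλs}`, and multiplying by the
unimodular `e^{iλτ}` then gives the kernel `e^{iλ(τ-s)}`. Neither operation changes the modulus. -/
lemma norm_pathIntegral_cexp (x : ℝ → ℝ) (h0 : x 0 = 0) (lam τ : ℝ) :
    ‖pathIntegral (fun s => Complex.exp (Complex.I * lam * s)) x τ‖ =
      ‖(x τ : ℂ) + driftPart x lam τ‖ := by
  have hconj : ∀ s : ℝ, (starRingEnd ℂ) (Complex.exp (Complex.I * lam * s)) =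
      Complex.exp (-(Complex.I * lam * s)) := fun s => by
    rw [← Complex.exp_conj]; simp
  have h1 : (starRingEnd ℂ) (pathIntegral (fun s => Complex.exp (Complex.I * lam * s)) x τ) =
      Complex.exp (-(Complex.I * lam * τ)) * (x τ + driftPart x lam τ) := by
    have he : Complex.exp (-(Complex.I * lam * τ)) * Complex.exp (Complex.I * lam * τ) = 1 := by
      rw [← Complex.exp_add]; simp
    have hic : ∀ f : ℝ → ℂ, (starRingEnd ℂ) (∫ s in (0 : ℝ)..τ, f s) =
        ∫ s in (0 : ℝ)..τ, (starRingEnd ℂ) (f s) := fun f => by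
      simp only [intervalIntegral, map_sub, integral_conj]
    simp only [pathIntegral, (hasDerivAt_cexp_mul lam _).deriv, h0, driftPart, map_sub, map_mul,
      hconj, hic, Complex.conj_ofReal, Complex.conj_I]
    have h4 : ∀ s : ℝ, (x s : ℂ) * (-Complex.I * lam * Complex.exp (-(Complex.I * lam * s))) =
      -(Complex.I * lam) * ((x s : ℂ) * Complex.exp (-(Complex.I * lam * s))) :=
      fun s => by ring
    simp only [h4, intervalIntegral.integral_const_mul]
    push_cast
    linear_combination -(Complex.I * lam * ∫ s in (0 : ℝ)..τ,
      (x s : ℂ) * Complex.exp (-(Complex.I * lam * s))) * he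
  have h2 : ‖Complex.exp (-(Complex.I * lam * τ))‖ = 1 := by
    rw [Complex.norm_exp]; simp
  rw [← RCLike.norm_conj, h1, norm_mul, h2, one_mul]

/-- By the equation `A' = iλ(x + A)`, both `(|A|²)'` and `-2 Re (x A')` equal `2λ x Im A`: the terms
`iλ|A|²` and `iλx²` are purely imaginary. Integrate from `A(0) = 0`. -/
lemma norm_driftPart_sq {x : ℝ → ℝ} (hx : Continuous x) (lam T : ℝ) :
    ‖driftPart x lam T‖ ^ 2 = -2 * (∫ s in (0 : ℝ)..T,
      (x s : ℂ) * (Complex.I * lam * (x s + driftPart x lam s))).re := by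
  have hA : Continuous (driftPart x lam) :=
    continuous_iff_continuousAt.2 fun t => (hasDerivAt_driftPart hx lam t).continuousAt
  have hcont : Continuous fun s : ℝ =>
      (x s : ℂ) * (Complex.I * lam * (x s + driftPart x lam s)) := by fun_prop
  have hre : (∫ s in (0 : ℝ)..T, (x s : ℂ) * (Complex.I * lam * (x s + driftPart x lam s))).re =
      ∫ s in (0 : ℝ)..T, ((x s : ℂ) * (Complex.I * lam * (x s + driftPart x lam s))).re :=
    (Complex.reCLM.intervalIntegral_comp_comm (hcont.intervalIntegrable 0 T)).symm
  have hd : ∀ t, HasDerivAt (fun t => ‖driftPart x lam t‖ ^ 2)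
      (-2 * ((x t : ℂ) * (Complex.I * lam * (x t + driftPart x lam t))).re) t := by
    intro t
    refine (hasDerivAt_driftPart hx lam t).norm_sq.congr_deriv ?_
    simp [Complex.inner]
    ring
  have hint : Continuous fun t : ℝ =>
      -2 * ((x t : ℂ) * (Complex.I * lam * (x t + driftPart x lam t))).re := by fun_prop
  have := intervalIntegral.integral_eq_sub_of_hasDerivAt (fun t _ => hd t)
    (hint.intervalIntegrable 0 T)
  rw [hre, ← intervalIntegral.integral_const_mul, this]
  simp [driftPart]

/-- Expanding `|x(T) + A(T)|²` is enough. The value `V` cancels against the `-V/2` inside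
`iteratedIntegral`, so nothing about quadratic variation enters here. -/
lemma periodogram_eq_of_continuous {x : ℝ → ℝ} (hx : Continuous x) (h0 : x 0 = 0)
    (V T lam : ℝ) :
    periodogram x T lam = V + 2 * (iteratedIntegral x V T lam).re := by
  have h := norm_driftPart_sq hx lam T
  rw [periodogram, norm_pathIntegral_cexp x h0, iteratedIntegral]
  rw [← Complex.normSq_eq_norm_sq, Complex.normSq_apply] at h ⊢
  simp only [Complex.add_re, Complex.sub_re, Complex.ofReal_re, Complex.add_im, Complex.ofReal_im,
    Complex.mul_re, mul_zero, sub_zero, zero_add] at h ⊢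
  linarith

/-- Left-point Riemann–Stieltjes sums of a `C¹` function against a continuous path converge. -/
lemma tendsto_sum_mul_sub {x : ℝ → ℝ} (hx : Continuous x) {A A' : ℝ → ℂ}
    (hA : ∀ t, HasDerivAt A (A' t) t) (hA' : Continuous A') (hT : 0 ≤ T)
    {ρ : ℕ → TimePartition T} (hρ : Tendsto (fun k => (ρ k).mesh) atTop (𝓝 0)) :
    Tendsto (fun k => ∑ i ∈ Finset.range (ρ k).n,
      A ((ρ k).t i) * ((x ((ρ k).t (i + 1)) - x ((ρ k).t i) : ℝ) : ℂ)) atTop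
      (𝓝 (A T * x T - A 0 * x 0 - ∫ s in (0 : ℝ)..T, (x s : ℂ) * A' s)) := by
  obtain ⟨C, hC⟩ := isCompact_Icc.exists_bound_of_continuousOn
    (hA'.continuousOn (s := Set.Icc 0 T))
  have hC0 : 0 ≤ C := (norm_nonneg _).trans (hC 0 ⟨le_rfl, hT⟩)
  have huc := Metric.uniformContinuousOn_iff.1
    (isCompact_Icc.uniformContinuousOn_of_continuous (hx.continuousOn (s := Set.Icc 0 T)))
  have hxA : Continuous fun s => (x s : ℂ) * A' s := by fun_prop
  rw [Metric.tendsto_atTop]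
  intro ε hε
  -- The total error is at most this tolerance times `C * T`; the `+ 1` keeps the denominator
  -- positive and the final inequality strict.
  obtain ⟨δ, hδ, hxδ⟩ := huc (ε / (C * T + 1)) (by positivity)
  obtain ⟨K, hK⟩ := Metric.tendsto_atTop.1 hρ δ hδ
  refine ⟨K, fun k hk => ?_⟩
  have hmesh : (ρ k).mesh < δ := by
    have := hK k hk
    rwa [Real.dist_0_eq_abs, abs_of_nonneg (ρ k).mesh_nonneg] at this
  set π := ρ k
  -- Summation by parts moves the differences onto `A`, leaving `x` at right endpoints.
  have hsum : ∑ i ∈ Finset.range π.n, A (π.t i) * ((x (π.t (i + 1)) - x (π.t i) : ℝ) : ℂ) =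
      A T * x T - A 0 * x 0 - ∑ i ∈ Finset.range π.n,
        (x (π.t (i + 1)) : ℂ) * (A (π.t (i + 1)) - A (π.t i)) := by
    have h := Finset.sum_range_sub (fun i => A (π.t i) * (x (π.t i) : ℂ)) π.n
    rw [π.t_last, π.t_zero] at h
    rw [← h, ← Finset.sum_sub_distrib]
    refine Finset.sum_congr rfl fun i _ => ?_
    push_cast
    ring
  have hint : ∫ s in (0 : ℝ)..T, (x s : ℂ) * A' s =
      ∑ i ∈ Finset.range π.n, ∫ s in (π.t i)..(π.t (i + 1)), (x s : ℂ) * A' s := by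
    rw [intervalIntegral.sum_integral_adjacent_intervals
      fun i _ => hxA.intervalIntegrable _ _, π.t_zero, π.t_last]
  rw [hsum, hint, dist_eq_norm, sub_sub_sub_cancel_left, ← Finset.sum_sub_distrib]
  have hterm : ∀ i ∈ Finset.range π.n,
      ‖(∫ s in (π.t i)..(π.t (i + 1)), (x s : ℂ) * A' s) -
        (x (π.t (i + 1)) : ℂ) * (A (π.t (i + 1)) - A (π.t i))‖ ≤
        ε / (C * T + 1) * C * (π.t (i + 1) - π.t i) := by
    intro i hi
    have hi := Finset.mem_range.1 hi
    have hlt := π.t_lt i hi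
    rw [← intervalIntegral.integral_eq_sub_of_hasDerivAt (fun t _ => hA t)
      (hA'.intervalIntegrable _ _), ← intervalIntegral.integral_const_mul,
      ← intervalIntegral.integral_sub (hxA.intervalIntegrable _ _)
        ((hA'.intervalIntegrable _ _).const_mul _)]
    refine (intervalIntegral.norm_integral_le_of_norm_le_const fun s hs => ?_).trans_eq
      (by rw [abs_of_pos (sub_pos.2 hlt)])
    rw [Set.uIoc_of_le hlt.le] at hs
    have h0 := (π.t_mem_Icc hi.le).1
    have h1 := π.t_mem_Icc (Nat.succ_le_of_lt hi)
    have hsI : s ∈ Set.Icc 0 T := ⟨h0.trans hs.1.le, hs.2.trans h1.2⟩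
    rw [← sub_mul, norm_mul, ← Complex.ofReal_sub, Complex.norm_real, Real.norm_eq_abs, ← Real.dist_eq]
    gcongr
    · refine (hxδ s hsI _ h1 ?_).le
      rw [Real.dist_eq, abs_sub_comm, abs_of_nonneg (sub_nonneg.2 hs.2)]
      linarith [π.sub_le_mesh hi, hs.1]
    · exact hC s hsI
  refine (norm_sum_le _ _).trans_lt ((Finset.sum_le_sum hterm).trans_lt ?_)
  rw [← Finset.mul_sum, π.sum_sub, mul_assoc, div_mul_eq_mul_div, div_lt_iff₀ (by positivity)]
  nlinarith

lemma tendsto_iteratedSum_of_continuous {x : ℝ → ℝ} (hx : Continuous x) (h0 : x 0 = 0)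
    (hT : 0 ≤ T) {ρ : ℕ → TimePartition T} (hρ : Tendsto (fun k => (ρ k).mesh) atTop (𝓝 0))
    {V : ℝ} (hV : Tendsto (fun k => quadSum x (ρ k)) atTop (𝓝 V)) (lam : ℝ) :
    Tendsto (fun k => iteratedSum x lam (ρ k)) atTop (𝓝 (iteratedIntegral x V T lam)) := by
  have hA : Continuous (driftPart x lam) :=
    continuous_iff_continuousAt.2 fun t => (hasDerivAt_driftPart hx lam t).continuousAt
  have h1 := tendsto_sum_mul_sub hx (hasDerivAt_driftPart hx lam) (by fun_prop) hT hρ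
  have h2 : Tendsto (fun k => (((x T ^ 2 - quadSum x (ρ k)) / 2 : ℝ) : ℂ)) atTop
      (𝓝 (((x T ^ 2 - V) / 2 : ℝ) : ℂ)) :=
    (Complex.continuous_ofReal.tendsto _).comp ((tendsto_const_nhds.sub hV).div_const 2)
  have h3 := h2.add h1
  simp only [h0, Complex.ofReal_zero, mul_zero, sub_zero] at h3
  refine h3.congr fun k => ?_
  -- Sum `2a(b - a) = b² - a² - (b - a)²` over the partition.
  have h4 : (x T ^ 2 - quadSum x (ρ k)) / 2 = ∑ i ∈ Finset.range (ρ k).n,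
      x ((ρ k).t i) * (x ((ρ k).t (i + 1)) - x ((ρ k).t i)) := by
    have h := Finset.sum_range_sub (fun i => x ((ρ k).t i) ^ 2) (ρ k).n
    rw [(ρ k).t_last, (ρ k).t_zero, h0] at h
    have h5 : x T ^ 2 = x T ^ 2 - 0 ^ 2 := by ring
    rw [h5, ← h, quadSum, ← Finset.sum_sub_distrib, Finset.sum_div]
    exact Finset.sum_congr rfl fun i _ => by ring
  rw [h4, Complex.ofReal_sum, ← Finset.sum_add_distrib]
  refine Finset.sum_congr rfl fun i _ => ?_
  rw [pathIntegral_cexp_sub x h0]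
  push_cast
  ring

lemma pathIntegral_congr {x y : ℝ → ℝ} (h : Set.EqOn x y (Set.Icc 0 T)) (f : ℝ → ℂ) {t : ℝ}
    (ht : t ∈ Set.Icc 0 T) : pathIntegral f x t = pathIntegral f y t := by
  have hi : ∫ s in (0 : ℝ)..t, (x s : ℂ) * deriv f s =
      ∫ s in (0 : ℝ)..t, (y s : ℂ) * deriv f s := by
    refine intervalIntegral.integral_congr fun s hs => ?_
    rw [Set.uIcc_of_le ht.1] at hs
    simp only [h ⟨hs.1, hs.2.trans ht.2⟩]
  simp only [pathIntegral, hi, h ht, h ⟨le_rfl, ht.1.trans ht.2⟩]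

lemma iteratedSum_congr {x y : ℝ → ℝ} (h : Set.EqOn x y (Set.Icc 0 T)) (lam : ℝ)
    (π : TimePartition T) : iteratedSum x lam π = iteratedSum y lam π := by
  refine Finset.sum_congr rfl fun i hi => ?_
  have hi := Finset.mem_range.1 hi
  rw [pathIntegral_congr h _ (π.t_mem_Icc hi.le), h (π.t_mem_Icc hi.le), h (π.t_mem_Icc hi)]

/-- The periodogram of a continuous path started at zero, and the convergence of the iterated
sums along partitions for which the realized quadratic variations converge. -/
theorem exists_tendsto_iteratedSum {x : ℝ → ℝ} (hx : ContinuousOn x (Set.Icc 0 T))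
    (h0 : x 0 = 0) (hT : 0 ≤ T) (V : ℝ) :
    ∃ J : ℝ → ℂ, (∀ lam, periodogram x T lam = V + 2 * (J lam).re) ∧
      ∀ ρ : ℕ → TimePartition T, Tendsto (fun k => (ρ k).mesh) atTop (𝓝 0) →
        Tendsto (fun k => quadSum x (ρ k)) atTop (𝓝 V) →
        ∀ lam, Tendsto (fun k => iteratedSum x lam (ρ k)) atTop (𝓝 (J lam)) := by
  -- Extending by constants makes the path continuous on the whole line, so that `driftPart` has
  -- two-sided derivatives everywhere; only values on `[0, T]` enter the conclusions.
  set y : ℝ → ℝ := Set.IccExtend hT ((Set.Icc 0 T).domRestrict x) with hy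
  have hyc : Continuous y := hx.domRestrict.Icc_extend'
  have hxy : Set.EqOn x y (Set.Icc 0 T) := fun t ht => by
    rw [hy, Set.IccExtend_of_mem hT _ ht, Set.domRestrict_apply]
  have hy0 : y 0 = 0 := by rw [← hxy ⟨le_rfl, hT⟩, h0]
  refine ⟨iteratedIntegral y V T, fun lam => ?_, fun ρ hρ hV lam => ?_⟩
  · rw [← periodogram_eq_of_continuous hyc hy0, periodogram, periodogram,
      pathIntegral_congr hxy _ ⟨hT, le_rfl⟩]
  · simp only [iteratedSum_congr hxy, quadSum_congr hxy] at hV ⊢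
    exact tendsto_iteratedSum_of_continuous hyc hy0 hT hρ hV lam

end Pathwise

/-! ### Reverse-time maximal inequality for independent symmetric increments -/

section SymmetricIncrements

lemma measurableSet_last_exceedance {α : Type*} [MeasurableSpace α] {S : ℕ → α → ℝ}
    (hS : ∀ k, Measurable (S k)) (k N : ℕ) (ε : ℝ) :
    MeasurableSet {y | ε ≤ |S k y| ∧ ∀ l ∈ Finset.Ioc k N, |S l y| < ε} := by
  have h : {y | ε ≤ |S k y| ∧ ∀ l ∈ Finset.Ioc k N, |S l y| < ε} =
      {y | ε ≤ |S k y|} ∩ ⋂ l ∈ Finset.Ioc k N, {y | |S l y| < ε} := by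
    ext y; simp
  rw [h]
  exact (measurableSet_le measurable_const (hS k).abs).inter
    (Finset.measurableSet_biInter _ fun l _ => measurableSet_lt (hS l).abs measurable_const)

/-- A maximal inequality in reverse time: if `S m` dominates each `S k` in mean square on
the event that `k` is the largest index at which `ε` is exceeded, then the probability that some
`S k` exceeds `ε` is controlled by the second moment of `S m`. -/
lemma sq_mul_measureReal_exists_le {α : Type*} [MeasurableSpace α] {μ : Measure α}
    [IsFiniteMeasure μ] {S : ℕ → α → ℝ} (hS : ∀ k, Measurable (S k))
    (hS2 : ∀ k, Integrable (fun y => S k y ^ 2) μ) {m N : ℕ} {ε : ℝ} (hε : 0 ≤ ε)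
    (h : ∀ k ∈ Finset.Icc m N,
      ∫ y in {y | ε ≤ |S k y| ∧ ∀ l ∈ Finset.Ioc k N, |S l y| < ε}, S k y ^ 2 ∂μ ≤
      ∫ y in {y | ε ≤ |S k y| ∧ ∀ l ∈ Finset.Ioc k N, |S l y| < ε}, S m y ^ 2 ∂μ) :
    ε ^ 2 * μ.real {y | ∃ k ∈ Finset.Icc m N, ε ≤ |S k y|} ≤ ∫ y, S m y ^ 2 ∂μ := by
  set A : ℕ → Set α := fun k => {y | ε ≤ |S k y| ∧ ∀ l ∈ Finset.Ioc k N, |S l y| < ε} with hA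
  have hAm : ∀ k, MeasurableSet (A k) := fun k => measurableSet_last_exceedance hS k N ε
  have hsub : {y | ∃ k ∈ Finset.Icc m N, ε ≤ |S k y|} ⊆ ⋃ k ∈ Finset.Icc m N, A k := by
    rintro y ⟨k, hk, hky⟩
    have hne : ((Finset.Icc m N).filter fun k => ε ≤ |S k y|).Nonempty :=
      ⟨k, Finset.mem_filter.2 ⟨hk, hky⟩⟩
    have hmax := Finset.mem_filter.1 (Finset.max'_mem _ hne)
    refine Set.mem_iUnion₂.2 ⟨_, hmax.1, hmax.2, fun l hl => ?_⟩
    by_contra hc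
    rw [Finset.mem_Ioc] at hl
    have := Finset.le_max' ((Finset.Icc m N).filter fun k => ε ≤ |S k y|) l
      (Finset.mem_filter.2 ⟨Finset.mem_Icc.2
        ⟨(Finset.mem_Icc.1 hmax.1).1.trans hl.1.le, hl.2⟩, not_lt.1 hc⟩)
    omega
  have hdisj : ((Finset.Icc m N : Finset ℕ) : Set ℕ).Pairwise (Function.onFun Disjoint A) := by
    have key : ∀ i j, j ∈ Finset.Icc m N → i < j → Disjoint (A i) (A j) := fun i j hj hij =>
      Set.disjoint_left.2 fun y hyi hyj =>
        absurd (hyi.2 j (Finset.mem_Ioc.2 ⟨hij, (Finset.mem_Icc.1 hj).2⟩)) (not_lt.2 hyj.1)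
    intro i hi j hj hij
    rcases lt_or_gt_of_ne hij with hlt | hlt
    · exact key i j hj hlt
    · exact (key j i hi hlt).symm
  calc ε ^ 2 * μ.real {y | ∃ k ∈ Finset.Icc m N, ε ≤ |S k y|}
      ≤ ε ^ 2 * ∑ k ∈ Finset.Icc m N, μ.real (A k) := by
        gcongr
        exact (measureReal_mono hsub (measure_ne_top _ _)).trans (measureReal_biUnion_finset_le _ _)
    _ = ∑ k ∈ Finset.Icc m N, ε ^ 2 * μ.real (A k) := Finset.mul_sum _ _ _
    _ ≤ ∑ k ∈ Finset.Icc m N, ∫ y in A k, S m y ^ 2 ∂μ := by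
        refine Finset.sum_le_sum fun k hk => le_trans ?_ (h k hk)
        refine setIntegral_ge_of_const_le_real (hAm k) (measure_ne_top _ _) (fun y hy => ?_)
          (hS2 k).integrableOn
        rw [← sq_abs (S k y)]
        exact pow_le_pow_left₀ hε hy.1 2
    _ = ∫ y in ⋃ k ∈ Finset.Icc m N, A k, S m y ^ 2 ∂μ :=
        (integral_biUnion_finset _ (fun k _ => hAm k) hdisj fun k _ => (hS2 m).integrableOn).symm
    _ ≤ ∫ y, S m y ^ 2 ∂μ :=
        setIntegral_le_integral (hS2 m) (ae_of_all _ fun y => sq_nonneg _)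

variable {T : ℝ}

/-- The step path with jump `y i` immediately after the `i`-th point of `π`. -/
def stepPath (π : TimePartition T) (y : Fin π.n → ℝ) (t : ℝ) : ℝ :=
  ∑ i : Fin π.n, if π.t i < t then y i else 0

/-- Changes the sign of the jumps of a step path at the partition points in `[u, v)`. -/
def flipOn (π : TimePartition T) (u v : ℝ) (y : Fin π.n → ℝ) (i : Fin π.n) : ℝ :=
  if u ≤ π.t i ∧ π.t i < v then -y i else y i

lemma stepPath_sub (π : TimePartition T) (y : Fin π.n → ℝ) {a b : ℝ} (hab : a ≤ b) :
    stepPath π y b - stepPath π y a =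
      ∑ i : Fin π.n, if a ≤ π.t i ∧ π.t i < b then y i else 0 := by
  rw [stepPath, stepPath, ← Finset.sum_sub_distrib]
  refine Finset.sum_congr rfl fun i _ => ?_
  split_ifs <;> grind

lemma stepPath_flipOn_sub_of_subset (π : TimePartition T) (y : Fin π.n → ℝ) {a b u v : ℝ}
    (hab : a ≤ b) (hua : u ≤ a) (hbv : b ≤ v) :
    stepPath π (flipOn π u v y) b - stepPath π (flipOn π u v y) a =
      -(stepPath π y b - stepPath π y a) := by
  rw [stepPath_sub π _ hab, stepPath_sub π _ hab, ← Finset.sum_neg_distrib]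
  refine Finset.sum_congr rfl fun i _ => ?_
  rw [flipOn]
  split_ifs <;> grind

lemma stepPath_flipOn_sub_of_disjoint (π : TimePartition T) (y : Fin π.n → ℝ) {a b u v : ℝ}
    (hab : a ≤ b) (h : b ≤ u ∨ v ≤ a) :
    stepPath π (flipOn π u v y) b - stepPath π (flipOn π u v y) a =
      stepPath π y b - stepPath π y a := by
  rw [stepPath_sub π _ hab, stepPath_sub π _ hab]
  refine Finset.sum_congr rfl fun i _ => ?_
  rw [flipOn]
  split_ifs <;> grind

/-- Sign changes on an interval between two points of a partition do not affect the realized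
quadratic variation along it. -/
lemma quadSum_stepPath_flipOn (π σ : TimePartition T) (y : Fin π.n → ℝ) {u v : ℝ}
    (hu : u ∈ σ.points) (hv : v ∈ σ.points) :
    quadSum (stepPath π (flipOn π u v y)) σ = quadSum (stepPath π y) σ := by
  refine Finset.sum_congr rfl fun j hj => ?_
  have hj := Finset.mem_range.1 hj
  have hab := (σ.t_lt j hj).le
  -- As `u` and `v` are points of `σ`, each interval of `σ` is inside `[u, v]`, where its increment
  -- changes sign, or outside, where it is unchanged.
  rcases σ.le_t_or_t_succ_le hu hj with h1 | h1
  · rcases σ.le_t_or_t_succ_le hv hj with h2 | h2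
    · rw [stepPath_flipOn_sub_of_disjoint π y hab (Or.inr h2)]
    · rw [stepPath_flipOn_sub_of_subset π y hab h1 h2, neg_sq]
  · rw [stepPath_flipOn_sub_of_disjoint π y hab (Or.inl h1)]

/-- The realized quadratic variation of a path along a coarser partition only depends on the
increments of the path along the finer one. -/
lemma quadSum_stepPath_increments (π σ : TimePartition T) (h : σ.points ⊆ π.points)
    (x : ℝ → ℝ) :
    quadSum (stepPath π fun i => x (π.t (i + 1)) - x (π.t i)) σ = quadSum x σ := by
  refine Finset.sum_congr rfl fun j hj => ?_
  have hj := Finset.mem_range.1 hj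
  have hab := (σ.t_lt j hj).le
  rw [stepPath_sub π _ hab, π.sub_eq_sum_ite x (h (σ.t_mem_points hj.le))
    (h (σ.t_mem_points hj)) hab, Finset.sum_range]

lemma measurable_stepPath (π : TimePartition T) (t : ℝ) :
    Measurable fun y => stepPath π y t := by
  refine Finset.measurable_sum _ fun i _ => ?_
  split_ifs
  · exact measurable_pi_apply i
  · exact measurable_const

lemma measurable_quadSum_stepPath (π σ : TimePartition T) :
    Measurable fun y => quadSum (stepPath π y) σ :=
  Finset.measurable_sum _ fun _ _ =>
    ((measurable_stepPath π _).sub (measurable_stepPath π _)).pow_const 2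

/-- Needed to multiply two `L⁴` increments into an `L²` function. -/
instance holderTriple_four_four_two : ENNReal.HolderTriple 4 4 2 where
  inv_add_inv_eq_inv := by
    have h : (4 : ENNReal) = 2 * 2 := by norm_num
    rw [h, ENNReal.mul_inv (by simp) (by simp), ← mul_add, ENNReal.inv_two_add_inv_two, mul_one]

section Symmetric

variable {π : TimePartition T} {μ : Fin π.n → Measure ℝ} [∀ i, IsProbabilityMeasure (μ i)]

lemma measurePreserving_flipOn (hμ : ∀ i, MeasurePreserving (fun x : ℝ => -x) (μ i) (μ i))
    (u v : ℝ) : MeasurePreserving (flipOn π u v) (Measure.pi μ) (Measure.pi μ) := by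
  refine measurePreserving_pi μ μ
    (f := fun i x => if u ≤ π.t i ∧ π.t i < v then -x else x) fun i => ?_
  split_ifs
  · exact hμ i
  · exact MeasurePreserving.id _

lemma memLp_stepPath (hμ4 : ∀ i, MemLp id 4 (μ i)) (t : ℝ) :
    MemLp (fun y => stepPath π y t) 4 (Measure.pi μ) := by
  refine memLp_finsetSum _ fun i _ => ?_
  split_ifs
  · exact (hμ4 i).comp_measurePreserving (measurePreserving_eval μ i)
  · exact MemLp.zero

lemma memLp_stepPath_sub_mul_sub (hμ4 : ∀ i, MemLp id 4 (μ i)) (a b c d : ℝ) :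
    MemLp (fun y => (stepPath π y b - stepPath π y a) * (stepPath π y d - stepPath π y c)) 2
      (Measure.pi μ) :=
  ((memLp_stepPath hμ4 d).sub (memLp_stepPath hμ4 c)).mul
    ((memLp_stepPath hμ4 b).sub (memLp_stepPath hμ4 a))

lemma memLp_quadSum_stepPath (hμ4 : ∀ i, MemLp id 4 (μ i)) (σ : TimePartition T) :
    MemLp (fun y => quadSum (stepPath π y) σ) 2 (Measure.pi μ) := by
  refine memLp_finsetSum _ fun i _ => ?_
  simpa only [sq] using memLp_stepPath_sub_mul_sub hμ4 _ _ _ _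

variable {σ : TimePartition T} {G : (Fin π.n → ℝ) → ℝ}

/-- Flipping the signs on the `i`-th interval of `σ` preserves the measure, `G` and the `j`-th
increment but negates the `i`-th one, so the integral equals its own negative. -/
lemma integral_increment_mul_increment_mul_eq_zero
    (hμ : ∀ i, MeasurePreserving (fun x : ℝ => -x) (μ i) (μ i)) (hGm : Measurable G)
    (hG : ∀ u ∈ σ.points, ∀ v ∈ σ.points, ∀ y, G (flipOn π u v y) = G y) {i j : ℕ} (hi : i < σ.n) (hj : j < σ.n)
    (hij : i ≠ j) :
    ∫ y, (stepPath π y (σ.t (i + 1)) - stepPath π y (σ.t i)) *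
      (stepPath π y (σ.t (j + 1)) - stepPath π y (σ.t j)) * G y ∂Measure.pi μ = 0 := by
  set F : (Fin π.n → ℝ) → ℝ := fun y =>
    (stepPath π y (σ.t (i + 1)) - stepPath π y (σ.t i)) *
      (stepPath π y (σ.t (j + 1)) - stepPath π y (σ.t j)) * G y with hF
  have hFm : Measurable F :=
    (((measurable_stepPath π _).sub (measurable_stepPath π _)).mul
      ((measurable_stepPath π _).sub (measurable_stepPath π _))).mul hGm
  have hmp := measurePreserving_flipOn hμ (σ.t i) (σ.t (i + 1))
  have h1 : ∫ y, F (flipOn π (σ.t i) (σ.t (i + 1)) y) ∂Measure.pi μ =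
      ∫ y, F y ∂Measure.pi μ := by
    conv_rhs => rw [← hmp.map_eq]
    rw [integral_map hmp.measurable.aemeasurable hFm.aestronglyMeasurable]
  have h2 : ∀ y, F (flipOn π (σ.t i) (σ.t (i + 1)) y) = -F y := fun y => by
    simp only [hF]
    rw [stepPath_flipOn_sub_of_subset π y (σ.t_lt i hi).le le_rfl le_rfl,
      stepPath_flipOn_sub_of_disjoint π y (σ.t_lt j hj).le,
      hG _ (σ.t_mem_points hi.le) _ (σ.t_mem_points hi)]
    · ring
    · rcases lt_or_gt_of_ne hij with h | h
      · exact Or.inr (σ.t_le_t h hj.le)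
      · exact Or.inl (σ.t_le_t h hi.le)
  simp only [h2, integral_neg] at h1
  linarith

/-- Realized quadratic variations along coarser and finer partitions have the same mean against
weights that are invariant under sign changes on the intervals of the finer one. -/
lemma integral_quadSum_mul_eq (hμ4 : ∀ i, MemLp id 4 (μ i))
    (hμ : ∀ i, MeasurePreserving (fun x : ℝ => -x) (μ i) (μ i))
    (hG2 : MemLp G 2 (Measure.pi μ)) (hGm : Measurable G)
    (hG : ∀ u ∈ σ.points, ∀ v ∈ σ.points, ∀ y, G (flipOn π u v y) = G y) {τ : TimePartition T} (hτ : τ.points ⊆ σ.points) :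
    ∫ y, quadSum (stepPath π y) τ * G y ∂Measure.pi μ =
      ∫ y, quadSum (stepPath π y) σ * G y ∂Measure.pi μ := by
  set η : ℕ → (Fin π.n → ℝ) → ℝ :=
    fun j y => stepPath π y (σ.t (j + 1)) - stepPath π y (σ.t j) with hη
  have hint : ∀ i j, Integrable (fun y => η i y * η j y * G y) (Measure.pi μ) := fun i j =>
    (memLp_stepPath_sub_mul_sub hμ4 _ _ _ _).integrable_mul hG2
  have hsq : ∀ y, quadSum (stepPath π y) τ * G y = ∑ i ∈ Finset.range τ.n,
      ∑ j ∈ Finset.range σ.n, ∑ k ∈ Finset.range σ.n,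
        ((if τ.t i ≤ σ.t j ∧ σ.t j < τ.t (i + 1) then (1 : ℝ) else 0) *
          (if τ.t i ≤ σ.t k ∧ σ.t k < τ.t (i + 1) then (1 : ℝ) else 0)) *
          (η j y * η k y * G y) := by
    intro y
    rw [quadSum, Finset.sum_mul]
    refine Finset.sum_congr rfl fun i hi => ?_
    have hi := Finset.mem_range.1 hi
    rw [σ.sub_eq_sum_ite (stepPath π y) (hτ (τ.t_mem_points hi.le)) (hτ (τ.t_mem_points hi))
      (τ.t_lt i hi).le, sq, Finset.sum_mul_sum, Finset.sum_mul]
    refine Finset.sum_congr rfl fun j _ => ?_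
    rw [Finset.sum_mul]
    refine Finset.sum_congr rfl fun k _ => ?_
    simp only [hη]
    split_ifs <;> ring
  -- After squaring each coarse increment as a sum of fine ones, only the diagonal survives
  -- integration.
  have hinner : ∀ i, ∀ j ∈ Finset.range σ.n, ∑ k ∈ Finset.range σ.n,
      ((if τ.t i ≤ σ.t j ∧ σ.t j < τ.t (i + 1) then (1 : ℝ) else 0) *
        (if τ.t i ≤ σ.t k ∧ σ.t k < τ.t (i + 1) then (1 : ℝ) else 0)) *
        ∫ y, η j y * η k y * G y ∂Measure.pi μ =
      (if τ.t i ≤ σ.t j ∧ σ.t j < τ.t (i + 1) then (1 : ℝ) else 0) *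
        ∫ y, η j y * η j y * G y ∂Measure.pi μ := by
    intro i j hj
    rw [Finset.sum_eq_single_of_mem j hj]
    · split_ifs <;> ring
    · intro k hk hkj
      rw [integral_increment_mul_increment_mul_eq_zero hμ hGm hG (Finset.mem_range.1 hj)
        (Finset.mem_range.1 hk) hkj.symm, mul_zero]
  calc ∫ y, quadSum (stepPath π y) τ * G y ∂Measure.pi μ
      = ∑ i ∈ Finset.range τ.n, ∑ j ∈ Finset.range σ.n, ∑ k ∈ Finset.range σ.n,
        ((if τ.t i ≤ σ.t j ∧ σ.t j < τ.t (i + 1) then (1 : ℝ) else 0) *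
          (if τ.t i ≤ σ.t k ∧ σ.t k < τ.t (i + 1) then (1 : ℝ) else 0)) *
          ∫ y, η j y * η k y * G y ∂Measure.pi μ := by
        simp only [hsq]
        rw [integral_finsetSum _ fun i _ => integrable_finsetSum _ fun j _ =>
          integrable_finsetSum _ fun k _ => (hint j k).const_mul _]
        refine Finset.sum_congr rfl fun i _ => ?_
        rw [integral_finsetSum _ fun j _ =>
          integrable_finsetSum _ fun k _ => (hint j k).const_mul _]
        refine Finset.sum_congr rfl fun j _ => ?_
        rw [integral_finsetSum _ fun k _ => (hint j k).const_mul _]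
        exact Finset.sum_congr rfl fun k _ => integral_const_mul _ _
    _ = ∑ i ∈ Finset.range τ.n, ∑ j ∈ Finset.range σ.n,
        (if τ.t i ≤ σ.t j ∧ σ.t j < τ.t (i + 1) then (1 : ℝ) else 0) *
          ∫ y, η j y * η j y * G y ∂Measure.pi μ :=
        Finset.sum_congr rfl fun i _ => Finset.sum_congr rfl (hinner i)
    _ = ∑ j ∈ Finset.range σ.n, ∫ y, η j y * η j y * G y ∂Measure.pi μ := by
        rw [Finset.sum_comm]
        refine Finset.sum_congr rfl fun j hj => ?_
        have hj := Finset.mem_range.1 hj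
        -- Each fine interval starts in exactly one coarse interval, so its square is counted once.
        rw [← Finset.sum_mul, τ.sum_ite_mem_Ico (σ.t_mem_Icc hj.le).1
          ((σ.t_lt j hj).trans_le (σ.t_mem_Icc hj).2), one_mul]
    _ = ∫ y, quadSum (stepPath π y) σ * G y ∂Measure.pi μ := by
        rw [← integral_finsetSum _ fun j _ => hint j j]
        refine integral_congr_ae (ae_of_all _ fun y => ?_)
        simp only [quadSum, Finset.sum_mul, hη, sq]

end Symmetric

/-- Maximal inequality for the realized quadratic variations of a path with independent symmetric
increments along nested partitions. -/
lemma sq_mul_measureReal_quadSum_le {ρ : ℕ → TimePartition T}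
    (hρ : TimePartition.IsNestedSeq ρ) {m N : ℕ} {μ : Fin (ρ N).n → Measure ℝ}
    [∀ i, IsProbabilityMeasure (μ i)] (hμ4 : ∀ i, MemLp id 4 (μ i))
    (hμ : ∀ i, MeasurePreserving (fun x : ℝ => -x) (μ i) (μ i)) (c : ℝ) {ε : ℝ} (hε : 0 ≤ ε) :
    ε ^ 2 * (Measure.pi μ).real
      {y | ∃ k ∈ Finset.Icc m N, ε ≤ |quadSum (stepPath (ρ N) y) (ρ k) - c|} ≤
      ∫ y, (quadSum (stepPath (ρ N) y) (ρ m) - c) ^ 2 ∂Measure.pi μ := by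
  set S : ℕ → (Fin (ρ N).n → ℝ) → ℝ :=
    fun k y => quadSum (stepPath (ρ N) y) (ρ k) - c with hSdef
  have hSm : ∀ k, Measurable (S k) :=
    fun k => (measurable_quadSum_stepPath (ρ N) (ρ k)).sub_const c
  have hS2 : ∀ k, MemLp (S k) 2 (Measure.pi μ) :=
    fun k => (memLp_quadSum_stepPath hμ4 (ρ k)).sub (memLp_const c)
  refine sq_mul_measureReal_exists_le hSm (fun k => (hS2 k).integrable_sq) hε fun k hk => ?_
  rw [Finset.mem_Icc] at hk
  set A : Set (Fin (ρ N).n → ℝ) :=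
    {y | ε ≤ |S k y| ∧ ∀ l ∈ Finset.Ioc k N, |S l y| < ε} with hA
  have hAm : MeasurableSet A := measurableSet_last_exceedance hSm k N ε
  -- Nesting is used here: the event `A` involves only indices from `k` on, whose partitions all
  -- contain the points of `ρ k`, so it is invariant under flips between those points. This is why
  -- the last exceedance, rather than the first, is the right stopping index.
  have hSflip : ∀ l, k ≤ l → ∀ u ∈ (ρ k).points, ∀ v ∈ (ρ k).points, ∀ y,
      S l (flipOn (ρ N) u v y) = S l y := fun l hl u hu v hv y => by
    simp only [hSdef]
    rw [quadSum_stepPath_flipOn _ _ _ (hρ.points_subset hl hu) (hρ.points_subset hl hv)]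
  set G : (Fin (ρ N).n → ℝ) → ℝ := A.indicator (S k) with hGdef
  have hGm : Measurable G := (hSm k).indicator hAm
  have hG2 : MemLp G 2 (Measure.pi μ) := (hS2 k).indicator hAm
  have hGflip : ∀ u ∈ (ρ k).points, ∀ v ∈ (ρ k).points, ∀ y,
      G (flipOn (ρ N) u v y) = G y := fun u hu v hv y => by
    have hmem : flipOn (ρ N) u v y ∈ A ↔ y ∈ A := by
      simp only [hA, Set.mem_ofPred_eq, hSflip k le_rfl u hu v hv y]
      refine and_congr Iff.rfl (forall₂_congr fun l hl => ?_)
      rw [hSflip l (Finset.mem_Ioc.1 hl).1.le u hu v hv y]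
    by_cases hy : y ∈ A
    · simp only [hGdef, Set.indicator_of_mem hy, Set.indicator_of_mem (hmem.2 hy)]
      exact hSflip k le_rfl u hu v hv y
    · simp only [hGdef, Set.indicator_of_notMem hy, Set.indicator_of_notMem (mt hmem.1 hy)]
  have horth := integral_quadSum_mul_eq hμ4 hμ hG2 hGm hGflip (hρ.points_subset hk.1)
  have hQG : ∀ l, Integrable (fun y => quadSum (stepPath (ρ N) y) (ρ l) * G y) (Measure.pi μ) :=
    fun l => (memLp_quadSum_stepPath hμ4 (ρ l)).integrable_mul hG2
  have hzero : ∫ y, (quadSum (stepPath (ρ N) y) (ρ m) * G y -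
      quadSum (stepPath (ρ N) y) (ρ k) * G y) ∂Measure.pi μ = 0 := by
    rw [integral_sub (hQG m) (hQG k), horth, sub_self]
  have hmi : Integrable (A.indicator fun y => S m y ^ 2) (Measure.pi μ) :=
    (hS2 m).integrable_sq.indicator hAm
  have hki : Integrable (A.indicator fun y => S k y ^ 2) (Measure.pi μ) :=
    (hS2 k).integrable_sq.indicator hAm
  rw [← integral_indicator hAm, ← integral_indicator hAm]
  -- Pointwise `S m ^ 2 ≥ S k ^ 2 + 2 * S k * (S m - S k)` on `A`; the constant `c` cancels in the
  -- difference, and the cross term integrates to zero by `hzero`.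
  have hle : ∫ y, (A.indicator (fun y => S k y ^ 2) y +
      2 * (quadSum (stepPath (ρ N) y) (ρ m) * G y -
        quadSum (stepPath (ρ N) y) (ρ k) * G y)) ∂Measure.pi μ ≤
      ∫ y, A.indicator (fun y => S m y ^ 2) y ∂Measure.pi μ := by
    refine integral_mono (hki.add (((hQG m).sub (hQG k)).const_mul 2)) hmi fun y => ?_
    by_cases hy : y ∈ A
    · simp only [hGdef, Set.indicator_of_mem hy, hSdef]
      nlinarith [sq_nonneg (quadSum (stepPath (ρ N) y) (ρ m) -
        quadSum (stepPath (ρ N) y) (ρ k))]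
    · simp only [hGdef, Set.indicator_of_notMem hy, mul_zero, sub_self, add_zero, le_refl]
  have hd : Integrable (fun y => 2 * (quadSum (stepPath (ρ N) y) (ρ m) * G y -
      quadSum (stepPath (ρ N) y) (ρ k) * G y)) (Measure.pi μ) :=
    ((hQG m).sub (hQG k)).const_mul 2
  rwa [integral_add hki hd, integral_const_mul, hzero, mul_zero, add_zero] at hle

end SymmetricIncrements

/-! ### Gaussian moments and Lévy's theorem for Brownian motion -/

section BrownianMotion

/-- The moment of order `2r` of the standard Gaussian distribution. -/
def gaussianMoment (r : ℕ) : ℝ := ∫ x, x ^ (2 * r) ∂gaussianReal 0 1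

lemma gaussianMoment_nonneg (r : ℕ) : 0 ≤ gaussianMoment r :=
  integral_nonneg fun x => by rw [pow_mul]; positivity

lemma gaussianMoment_one : gaussianMoment 1 = 1 := by
  have h := variance_fun_id_gaussianReal (μ := 0) (v := 1)
  rw [variance_of_integral_eq_zero (by fun_prop) (by simp)] at h
  simpa [gaussianMoment] using h

lemma integral_pow_gaussianReal (v : NNReal) (r : ℕ) :
    ∫ x, x ^ (2 * r) ∂gaussianReal 0 v = v ^ r * gaussianMoment r := by
  have h : gaussianReal 0 v = (gaussianReal 0 1).map (√(v : ℝ) * ·) := by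
    rw [gaussianReal_map_const_mul, mul_zero, mul_one]
    congr 1
    ext
    simp
  rw [h, integral_map (by fun_prop) (by fun_prop), gaussianMoment, ← integral_const_mul]
  refine integral_congr_ae (ae_of_all _ fun x => ?_)
  simp only [mul_pow, pow_mul, Real.sq_sqrt (NNReal.coe_nonneg v)]

section Gaussian

variable {Ω : Type*} [MeasurableSpace Ω] {P : Measure Ω} {Y : Ω → ℝ} {v : NNReal}

lemma integral_pow_of_hasLaw_gaussianReal (hY : HasLaw Y (gaussianReal 0 v) P) (r : ℕ) :
    ∫ ω, Y ω ^ (2 * r) ∂P = v ^ r * gaussianMoment r := by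
  rw [← integral_pow_gaussianReal, ← hY.integral_comp (f := fun x => x ^ (2 * r)) (by fun_prop)]
  rfl

lemma memLp_of_hasLaw_gaussianReal (hY : HasLaw Y (gaussianReal 0 v) P) {p : ENNReal}
    (hp : p ≠ ⊤) : MemLp Y p P := by
  have h := memLp_id_gaussianReal' (μ := 0) (v := v) p hp
  rw [← hY.map_eq] at h
  exact (memLp_map_measure_iff aestronglyMeasurable_id hY.aemeasurable).1 h

lemma integrable_pow_of_hasLaw_gaussianReal (hY : HasLaw Y (gaussianReal 0 v) P) (r : ℕ) :
    Integrable (fun ω => Y ω ^ (2 * r)) P := by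
  by_cases hr : 2 * r = 0
  · have := hY.isProbabilityMeasure
    simp [hr]
  · have h := (memLp_of_hasLaw_gaussianReal hY (p := (2 * r : ℕ))
      (ENNReal.natCast_ne_top _)).integrable_norm_pow hr
    refine h.congr (ae_of_all _ fun ω => ?_)
    simp only [Real.norm_eq_abs, pow_mul, sq_abs]

end Gaussian

namespace IsBrownianOn

variable {Ω : Type*} [MeasurableSpace Ω] {P : Measure Ω} {T : ℝ}
  {W : ℝ → Ω → ℝ}

lemma hasLaw_increment (hW : IsBrownianOn W T P) (π : TimePartition T) (i : Fin π.n) :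
    HasLaw (fun ω => W (π.t (i + 1)) ω - W (π.t i) ω)
      (gaussianReal 0 (π.t (i + 1) - π.t i).toNNReal) P :=
  hW.law_increments _ _ (π.t_mem_Icc i.2.le).1 (π.t_lt i i.2).le (π.t_mem_Icc i.2).2

lemma iIndepFun_increments (hW : IsBrownianOn W T P) (π : TimePartition T) :
    iIndepFun (fun (i : Fin π.n) ω => W (π.t (i + 1)) ω - W (π.t i) ω) P :=
  hW.indep_increments π.n (fun i => ⟨π.t i, π.t_mem_Icc (Nat.lt_succ_iff.1 i.2)⟩)
    fun _ j hij => π.t_le_t hij (Nat.lt_succ_iff.1 j.2)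

lemma hasLaw_pi_increments (hW : IsBrownianOn W T P) (π : TimePartition T) :
    HasLaw (fun ω (i : Fin π.n) => W (π.t (i + 1)) ω - W (π.t i) ω)
      (Measure.pi fun i : Fin π.n => gaussianReal 0 (π.t (i + 1) - π.t i).toNNReal) P :=
  (hW.iIndepFun_increments π).hasLaw_pi (hW.hasLaw_increment π)

lemma memLp_quadSum (hW : IsBrownianOn W T P) (π : TimePartition T) :
    MemLp (fun ω => quadSum (fun t => W t ω) π) 2 P := by
  refine memLp_finsetSum _ fun i hi => ?_
  have h := memLp_of_hasLaw_gaussianReal (hW.hasLaw_increment π ⟨i, Finset.mem_range.1 hi⟩)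
    (p := 4) (by norm_num)
  simpa only [sq] using h.mul' h

variable [IsProbabilityMeasure P]

/-- The realized quadratic variation of a Brownian motion is close to `T` in mean square. -/
lemma integral_quadSum_sub_sq_le (hW : IsBrownianOn W T P) (π : TimePartition T) :
    ∫ ω, (quadSum (fun t => W t ω) π - T) ^ 2 ∂P ≤ gaussianMoment 2 * T * π.mesh := by
  set ξ : Fin π.n → Ω → ℝ := fun i ω => W (π.t (i + 1)) ω - W (π.t i) ω with hξ
  have hlaw : ∀ i, HasLaw (ξ i) (gaussianReal 0 (π.t (i + 1) - π.t i).toNNReal) P :=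
    hW.hasLaw_increment π
  have hv : ∀ i : Fin π.n, (((π.t (i + 1) - π.t i).toNNReal : NNReal) : ℝ) =
      π.t (i + 1) - π.t i := fun i => Real.coe_toNNReal _ (sub_nonneg.2 (π.t_lt i i.2).le)
  have hQ : (fun ω => quadSum (fun t => W t ω) π) = ∑ i, fun ω => ξ i ω ^ 2 := by
    ext ω
    rw [Finset.sum_apply, quadSum, Finset.sum_range]
  have hmem : ∀ i, MemLp (fun ω => ξ i ω ^ 2) 2 P := fun i => by
    have h := memLp_of_hasLaw_gaussianReal (hlaw i) (p := 4) (by norm_num)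
    simpa only [sq] using h.mul' h
  have hmean : ∫ ω, quadSum (fun t => W t ω) π ∂P = T := by
    have h1 : ∀ i : Fin π.n, ∫ ω, ξ i ω ^ 2 ∂P = π.t (i + 1) - π.t i := fun i => by
      have := integral_pow_of_hasLaw_gaussianReal (hlaw i) 1
      rwa [gaussianMoment_one, mul_one, mul_one, pow_one, hv] at this
    simp only [quadSum, Finset.sum_range]
    rw [integral_finsetSum _ fun i _ => (hmem i).integrable one_le_two,
      Finset.sum_congr rfl fun i _ => h1 i,
      ← Finset.sum_range (fun i => π.t (i + 1) - π.t i), π.sum_sub]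
  have hvar : Var[fun ω => quadSum (fun t => W t ω) π; P] =
      ∫ ω, (quadSum (fun t => W t ω) π - T) ^ 2 ∂P := by
    rw [variance_eq_integral (hW.memLp_quadSum π).aestronglyMeasurable.aemeasurable, hmean]
  have hsum : Var[fun ω => quadSum (fun t => W t ω) π; P] =
      ∑ i, Var[fun ω => ξ i ω ^ 2; P] := by
    rw [hQ]
    refine IndepFun.variance_sum (fun i _ => hmem i) fun i _ j _ hij => ?_
    exact ((hW.iIndepFun_increments π).indepFun hij).comp (φ := fun x : ℝ => x ^ 2)
      (ψ := fun x : ℝ => x ^ 2) (by fun_prop) (by fun_prop)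
  rw [← hvar, hsum]
  -- Bound the variance by the fourth moment, which is a constant times `(Δt)²`; one factor `Δt`
  -- becomes the mesh and the other sums to `T`.
  have hterm : ∀ i : Fin π.n, Var[fun ω => ξ i ω ^ 2; P] ≤
      gaussianMoment 2 * π.mesh * (π.t (i + 1) - π.t i) := fun i => by
    refine (variance_le_expectation_sq (hmem i).aestronglyMeasurable).trans ?_
    have h4 := integral_pow_of_hasLaw_gaussianReal (hlaw i) 2
    simp only [Pi.pow_apply, ← pow_mul]
    rw [h4, hv]
    have h0 := sub_nonneg.2 (π.t_lt i i.2).le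
    calc (π.t (i + 1) - π.t i) ^ 2 * gaussianMoment 2
        = gaussianMoment 2 * (π.t (i + 1) - π.t i) * (π.t (i + 1) - π.t i) := by ring
      _ ≤ gaussianMoment 2 * π.mesh * (π.t (i + 1) - π.t i) := by
        gcongr
        · exact gaussianMoment_nonneg 2
        · exact π.sub_le_mesh i.2
  refine (Finset.sum_le_sum fun i _ => hterm i).trans_eq ?_
  rw [← Finset.mul_sum, ← Finset.sum_range (fun i => π.t (i + 1) - π.t i), π.sum_sub]
  ring

/-- The maximal inequality for the realized quadratic variations of a Brownian motion along
finitely many nested partitions. -/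
lemma sq_mul_measureReal_exists_le (hW : IsBrownianOn W T P) {ρ : ℕ → TimePartition T}
    (hρ : TimePartition.IsNestedSeq ρ) (m N : ℕ) {ε : ℝ} (hε : 0 ≤ ε) :
    ε ^ 2 * P.real {ω | ∃ k ∈ Finset.Icc m N, ε ≤ |quadSum (fun t => W t ω) (ρ k) - T|} ≤
      gaussianMoment 2 * T * (ρ m).mesh := by
  rcases lt_or_ge N m with hNm | hmN
  · have h0 : {ω | ∃ k ∈ Finset.Icc m N, ε ≤ |quadSum (fun t => W t ω) (ρ k) - T|} = ∅ := by
      rw [Finset.Icc_eq_empty (by omega)]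
      simp
    rw [h0, measureReal_empty, mul_zero]
    exact (integral_nonneg fun ω => sq_nonneg _).trans (hW.integral_quadSum_sub_sq_le (ρ m))
  · have hlaw := hW.hasLaw_pi_increments (ρ N)
    -- All partitions up to level `N` see only the increments along `ρ N`, so the question lives on
    -- a finite product of centred Gaussian measures.
    have hQ : ∀ k ≤ N, ∀ ω, quadSum (stepPath (ρ N) fun i =>
        W ((ρ N).t (i + 1)) ω - W ((ρ N).t i) ω) (ρ k) = quadSum (fun t => W t ω) (ρ k) :=
      fun k hk ω => quadSum_stepPath_increments _ _ (hρ.points_subset hk) fun t => W t ω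
    have hmax := sq_mul_measureReal_quadSum_le hρ (m := m) (N := N)
      (μ := fun i => gaussianReal 0 ((ρ N).t (i + 1) - (ρ N).t i).toNNReal)
      (fun i => memLp_id_gaussianReal' 4 (by norm_num))
      (fun i => ⟨measurable_neg, by rw [gaussianReal_map_neg, neg_zero]⟩) T hε
    have hset : MeasurableSet {y | ∃ k ∈ Finset.Icc m N,
        ε ≤ |quadSum (stepPath (ρ N) y) (ρ k) - T|} := by
      have h : {y | ∃ k ∈ Finset.Icc m N, ε ≤ |quadSum (stepPath (ρ N) y) (ρ k) - T|} =
          ⋃ k ∈ Finset.Icc m N, {y | ε ≤ |quadSum (stepPath (ρ N) y) (ρ k) - T|} := by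
        ext y; simp
      rw [h]
      exact Finset.measurableSet_biUnion _ fun k _ => measurableSet_le measurable_const
        ((measurable_quadSum_stepPath _ _).sub_const T).abs
    rw [← hlaw.measureReal_eq hset, ← hlaw.integral_comp
      (f := fun y => (quadSum (stepPath (ρ N) y) (ρ m) - T) ^ 2)
      (((measurable_quadSum_stepPath _ _).sub_const T).pow_const 2).aestronglyMeasurable] at hmax
    simp only [Function.comp_def, hQ m hmN] at hmax
    refine le_trans (le_of_eq ?_) (hmax.trans (hW.integral_quadSum_sub_sq_le (ρ m)))
    congr 3
    ext ω
    refine exists_congr fun k => and_congr_right fun hk => ?_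
    rw [hQ k (Finset.mem_Icc.1 hk).2]

/-- **Lévy's theorem**: the realized quadratic variations of a Brownian motion along nested
partitions converge almost surely to `T`. -/
theorem ae_tendsto_quadSum (hW : IsBrownianOn W T P) {ρ : ℕ → TimePartition T}
    (hρ : TimePartition.IsNestedSeq ρ) :
    ∀ᵐ ω ∂P, Tendsto (fun k => quadSum (fun t => W t ω) (ρ k)) atTop (𝓝 T) := by
  have hbound : ∀ ε > 0, ∀ m,
      P {ω | ∃ k ≥ m, ε ≤ |quadSum (fun t => W t ω) (ρ k) - T|} ≤
        ENNReal.ofReal (gaussianMoment 2 * T * (ρ m).mesh / ε ^ 2) := by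
    intro ε hε m
    set E : ℕ → Set Ω :=
      fun N => {ω | ∃ k ∈ Finset.Icc m N, ε ≤ |quadSum (fun t => W t ω) (ρ k) - T|} with hE
    have hmono : Monotone E := fun N M hNM ω ⟨k, hk, hω⟩ =>
      ⟨k, Finset.Icc_subset_Icc_right hNM hk, hω⟩
    have hU : {ω | ∃ k ≥ m, ε ≤ |quadSum (fun t => W t ω) (ρ k) - T|} = ⋃ N, E N := by
      ext ω
      simp only [hE, Set.mem_ofPred_eq, Set.mem_iUnion, Finset.mem_Icc]
      exact ⟨fun ⟨k, hk, h⟩ => ⟨k, k, ⟨hk, le_rfl⟩, h⟩, fun ⟨N, k, hk, h⟩ => ⟨k, hk.1, h⟩⟩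
    rw [hU]
    -- The finite maximal inequality is uniform in `N`, so it passes to the increasing union.
    refine le_of_tendsto (tendsto_measure_iUnion_atTop hmono) (Eventually.of_forall fun N => ?_)
    rw [Function.comp_apply, ← ofReal_measureReal]
    refine ENNReal.ofReal_le_ofReal ?_
    rw [le_div_iff₀ (by positivity), mul_comm]
    exact hW.sq_mul_measureReal_exists_le hρ m N hε.le
  have hev : ∀ ε > 0, ∀ᵐ ω ∂P, ∃ m, ∀ k ≥ m, |quadSum (fun t => W t ω) (ρ k) - T| < ε := by
    intro ε hε
    have hlim : Tendsto (fun m => ENNReal.ofReal (gaussianMoment 2 * T * (ρ m).mesh / ε ^ 2))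
        atTop (𝓝 0) := by
      have h := (hρ.mesh_tendsto.const_mul (gaussianMoment 2 * T)).div_const (ε ^ 2)
      rw [mul_zero, zero_div] at h
      simpa using ENNReal.tendsto_ofReal h
    -- The exceptional event lies in the exceedance event after every `m`, whose probability bound
    -- tends to zero with the mesh.
    refine le_antisymm (ge_of_tendsto' hlim fun m => (measure_mono fun ω hω => ?_).trans
      (hbound ε hε m)) (zero_le)
    have hω' : ¬ ∃ m, ∀ k ≥ m, |quadSum (fun t => W t ω) (ρ k) - T| < ε := hω
    push Not at hω'
    exact hω' m
  have hall := ae_all_iff.2 fun n : ℕ => hev (1 / ((n : ℝ) + 1)) (by positivity)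
  filter_upwards [hall] with ω hω
  rw [Metric.tendsto_atTop]
  intro ε hε
  obtain ⟨n, hn⟩ := exists_nat_one_div_lt hε
  obtain ⟨m, hm⟩ := hω n
  exact ⟨m, fun k hk => by rw [Real.dist_eq]; exact (hm k hk).trans hn⟩

end IsBrownianOn

end BrownianMotion

/-! ### Hölder regularity and vanishing quadratic variation of fractional Brownian motion -/

section FractionalBrownianMotion

lemma floor_two_mul {y : ℝ} (hy : 0 ≤ y) :
    ⌊2 * y⌋₊ = 2 * ⌊y⌋₊ ∨ ⌊2 * y⌋₊ = 2 * ⌊y⌋₊ + 1 := by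
  have h1 := Nat.floor_le hy
  have h2 := Nat.lt_floor_add_one y
  rcases lt_or_ge (2 * y) (2 * ⌊y⌋₊ + 1) with h | h
  · left
    rw [Nat.floor_eq_iff (by positivity)]
    push_cast
    constructor <;> linarith
  · right
    rw [Nat.floor_eq_iff (by positivity)]
    push_cast
    constructor <;> linarith

section Chaining

variable {T : ℝ} {x : ℝ → ℝ} {K q : ℝ}

/-- The largest dyadic point of level `n` of `[0, T]` below `t`. -/
def dyadicFloor (T t : ℝ) (n : ℕ) : ℝ := ⌊t / (T * (1 / 2) ^ n)⌋₊ * (T * (1 / 2) ^ n)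

lemma dyadicFloor_le (hT : 0 < T) {t : ℝ} (ht : 0 ≤ t) (n : ℕ) : dyadicFloor T t n ≤ t := by
  have hd : 0 < T * (1 / 2 : ℝ) ^ n := by positivity
  rw [dyadicFloor, ← le_div_iff₀ hd]
  exact Nat.floor_le (by positivity)

lemma lt_dyadicFloor_add (hT : 0 < T) (t : ℝ) (n : ℕ) :
    t < dyadicFloor T t n + T * (1 / 2) ^ n := by
  have hd : 0 < T * (1 / 2 : ℝ) ^ n := by positivity
  have h := Nat.lt_floor_add_one (t / (T * (1 / 2 : ℝ) ^ n))
  rw [div_lt_iff₀ hd] at h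
  rw [dyadicFloor]
  linarith

lemma tendsto_dyadicFloor (hT : 0 < T) {t : ℝ} (ht : 0 ≤ t) :
    Tendsto (dyadicFloor T t) atTop (𝓝 t) := by
  have h : Tendsto (fun n : ℕ => t - T * (1 / 2 : ℝ) ^ n) atTop (𝓝 t) := by
    have := (tendsto_pow_atTop_nhds_zero_of_lt_one (r := (1 / 2 : ℝ)) (by norm_num)
      (by norm_num)).const_mul T
    simpa using tendsto_const_nhds.sub this
  refine tendsto_of_tendsto_of_tendsto_of_le_of_le h tendsto_const_nhds (fun n => ?_)
    fun n => dyadicFloor_le hT ht n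
  linarith [lt_dyadicFloor_add hT t n]

lemma floor_le_two_pow (hT : 0 < T) {t : ℝ} (ht : t ≤ T) (n : ℕ) :
    ⌊t / (T * (1 / 2) ^ n)⌋₊ ≤ 2 ^ n := by
  refine Nat.floor_le_of_le ?_
  rw [div_le_iff₀ (by positivity)]
  push_cast
  rw [mul_left_comm, ← mul_pow]
  norm_num
  exact ht

/-- A continuous path with geometrically small dyadic increments is close to its values at dyadic
points. -/
lemma abs_dyadicFloor_sub_le (hT : 0 < T) (hx : ContinuousOn x (Set.Icc 0 T)) (hK : 0 ≤ K)
    (hq0 : 0 < q) (hq1 : q < 1)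
    (h : ∀ n : ℕ, ∀ k < 2 ^ n, |x (((k + 1 : ℕ) : ℝ) * (T * (1 / 2) ^ n)) -
      x ((k : ℝ) * (T * (1 / 2) ^ n))| ≤ K * q ^ n) {t : ℝ} (ht : t ∈ Set.Icc 0 T) (n : ℕ) :
    |x (dyadicFloor T t n) - x t| ≤ K * q ^ n / (1 - q) := by
  have hmem : ∀ n, dyadicFloor T t n ∈ Set.Icc 0 T := fun n =>
    ⟨by rw [dyadicFloor]; positivity, (dyadicFloor_le hT ht.1 n).trans ht.2⟩
  have hstep : ∀ n, dist (x (dyadicFloor T t n)) (x (dyadicFloor T t (n + 1))) ≤ K * q ^ n := by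
    intro n
    have hd : (0 : ℝ) < T * (1 / 2) ^ n := by positivity
    have h2 : t / (T * (1 / 2 : ℝ) ^ (n + 1)) = 2 * (t / (T * (1 / 2) ^ n)) := by
      rw [pow_succ]
      field_simp
    have hprev : dyadicFloor T t n =
        ((2 * ⌊t / (T * (1 / 2 : ℝ) ^ n)⌋₊ : ℕ) : ℝ) * (T * (1 / 2) ^ (n + 1)) := by
      rw [dyadicFloor]
      push_cast
      ring
    have hfl := floor_two_mul (y := t / (T * (1 / 2 : ℝ) ^ n)) (div_nonneg ht.1 hd.le)
    rw [← h2] at hfl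
    have hle := floor_le_two_pow hT ht.2 (n + 1)
    -- Passing to the next level either keeps the dyadic point or moves it right by one interval of
    -- level `n + 1`.
    rcases hfl with hfl | hfl
    · have : dyadicFloor T t (n + 1) = dyadicFloor T t n := by
        rw [hprev, dyadicFloor, hfl]
      rw [this, dist_self]
      positivity
    · rw [hfl] at hle
      have hk := h (n + 1) (2 * ⌊t / (T * (1 / 2 : ℝ) ^ n)⌋₊) (by omega)
      rw [← hfl, ← hprev] at hk
      rw [dist_comm, Real.dist_eq]
      exact hk.trans (mul_le_mul_of_nonneg_left
        (pow_le_pow_of_le_one hq0.le hq1.le n.le_succ) hK)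
  have hlim : Tendsto (fun n => x (dyadicFloor T t n)) atTop (𝓝 (x t)) :=
    (hx t ht).tendsto.comp (tendsto_nhdsWithin_iff.2
      ⟨tendsto_dyadicFloor hT ht.1, Eventually.of_forall hmem⟩)
  rw [← Real.dist_eq]
  exact dist_le_of_le_geometric_of_tendsto q K hq1 hstep hlim n

/-- A continuous path with geometrically small dyadic increments is Hölder continuous. -/
lemma exists_holder_of_dyadic (hT : 0 < T) (hx : ContinuousOn x (Set.Icc 0 T)) (hK : 0 ≤ K)
    {γ : ℝ} (hγ : 0 < γ)
    (h : ∀ n : ℕ, ∀ k < 2 ^ n, |x (((k + 1 : ℕ) : ℝ) * (T * (1 / 2) ^ n)) -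
      x ((k : ℝ) * (T * (1 / 2) ^ n))| ≤ K * ((1 / 2 : ℝ) ^ γ) ^ n) :
    ∃ C, 0 ≤ C ∧ ∀ s ∈ Set.Icc 0 T, ∀ t ∈ Set.Icc 0 T, s < t →
      |x t - x s| ≤ C * (t - s) ^ γ := by
  set q : ℝ := (1 / 2 : ℝ) ^ γ with hq
  have hq0 : 0 < q := by positivity
  have hq1 : q < 1 := Real.rpow_lt_one (by norm_num) (by norm_num) hγ
  have h1q : 0 < 1 - q := sub_pos.2 hq1
  refine ⟨(2 * K / (1 - q) + K) * (2 / T) ^ γ, by positivity, fun s hs t ht hst => ?_⟩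
  have hts : 0 < t - s := sub_pos.2 hst
  -- The level matches the gap: `T / 2 ^ (n + 1) < t - s ≤ T / 2 ^ n`. The lower bound converts `q ^
  -- n` into `(t - s) ^ γ`; the upper one makes the two dyadic floors equal or adjacent.
  obtain ⟨n, hn1, hn2⟩ := exists_nat_pow_near_of_lt_one (x := (t - s) / T) (y := (1 / 2 : ℝ))
    (by positivity) (by rw [div_le_one hT]; linarith [hs.1, ht.2]) (by norm_num) (by norm_num)
  have hd : (0 : ℝ) < T * (1 / 2) ^ n := by positivity
  have hqn : q ^ n ≤ (2 / T) ^ γ * (t - s) ^ γ := by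
    rw [hq, Real.rpow_pow_comm (by norm_num), ← Real.mul_rpow (by positivity) hts.le]
    refine Real.rpow_le_rpow (by positivity) ?_ hγ.le
    rw [pow_succ] at hn1
    have : 2 / T * (t - s) = 2 * ((t - s) / T) := by ring
    linarith
  have hmid : |x (dyadicFloor T t n) - x (dyadicFloor T s n)| ≤ K * q ^ n := by
    set a := s / (T * (1 / 2 : ℝ) ^ n) with ha
    set b := t / (T * (1 / 2 : ℝ) ^ n) with hb
    have hab : a ≤ b := by rw [ha, hb]; gcongr
    have hba : b ≤ a + 1 := by
      rw [ha, hb, ← sub_le_iff_le_add', ← sub_div, div_le_one hd, mul_comm, ← div_le_iff₀ hT]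
      exact hn2
    have ha0 : 0 ≤ a := div_nonneg hs.1 hd.le
    have h1 : ⌊a⌋₊ ≤ ⌊b⌋₊ := Nat.floor_mono hab
    have h2 : ⌊b⌋₊ ≤ ⌊a⌋₊ + 1 := by
      rw [← Nat.floor_add_one ha0]
      exact Nat.floor_mono hba
    have hle := floor_le_two_pow hT ht.2 n
    rw [← hb] at hle
    rw [dyadicFloor, dyadicFloor, ← ha, ← hb]
    rcases h1.eq_or_lt with h3 | h3
    · rw [h3, sub_self, abs_zero]
      positivity
    · have h4 : ⌊b⌋₊ = ⌊a⌋₊ + 1 := by omega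
      rw [h4]
      exact h n _ (by omega)
  have hs' := abs_dyadicFloor_sub_le hT hx hK hq0 hq1 h hs n
  have ht' := abs_dyadicFloor_sub_le hT hx hK hq0 hq1 h ht n
  calc |x t - x s|
      ≤ |x (dyadicFloor T t n) - x t| + |x (dyadicFloor T t n) - x (dyadicFloor T s n)| +
        |x (dyadicFloor T s n) - x s| := by
        rw [abs_sub_comm (x (dyadicFloor T t n)) (x t)]
        exact (abs_sub_le _ (x (dyadicFloor T s n)) _).trans
          (add_le_add (abs_sub_le _ _ _) le_rfl)
    _ ≤ K * q ^ n / (1 - q) + K * q ^ n + K * q ^ n / (1 - q) := by gcongr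
    _ = (2 * K / (1 - q) + K) * q ^ n := by ring
    _ ≤ (2 * K / (1 - q) + K) * ((2 / T) ^ γ * (t - s) ^ γ) := by gcongr
    _ = (2 * K / (1 - q) + K) * (2 / T) ^ γ * (t - s) ^ γ := by ring

end Chaining

variable {T : ℝ}

/-- Bound `p - 1` of the powers by the mesh and let the remaining factor sum to `T`. For `p > 1` the
bound vanishes with the mesh, which is where Hurst parameters above `1/2` enter. -/
lemma sum_rpow_increments_le (π : TimePartition T) {p : ℝ} (hp : 1 ≤ p) :
    ∑ i ∈ Finset.range π.n, (π.t (i + 1) - π.t i) ^ p ≤ π.mesh ^ (p - 1) * T := by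
  have hsum : π.mesh ^ (p - 1) * T =
      ∑ i ∈ Finset.range π.n, π.mesh ^ (p - 1) * (π.t (i + 1) - π.t i) := by
    rw [← Finset.mul_sum, π.sum_sub]
  rw [hsum]
  refine Finset.sum_le_sum fun i hi => ?_
  have hi := Finset.mem_range.1 hi
  have hpos := sub_pos.2 (π.t_lt i hi)
  calc (π.t (i + 1) - π.t i) ^ p
      = (π.t (i + 1) - π.t i) ^ (p - 1) * (π.t (i + 1) - π.t i) := by
        conv_rhs => rw [← Real.rpow_add_one hpos.ne', sub_add_cancel]
    _ ≤ π.mesh ^ (p - 1) * (π.t (i + 1) - π.t i) :=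
        mul_le_mul_of_nonneg_right
          (Real.rpow_le_rpow hpos.le (π.sub_le_mesh hi) (by linarith)) hpos.le

lemma tendsto_mesh_rpow {ι : Type*} {l : Filter ι} {ρ : ι → TimePartition T}
    (hρ : Tendsto (fun k => (ρ k).mesh) l (𝓝 0)) {p : ℝ} (hp : 0 < p) (c : ℝ) :
    Tendsto (fun k => (ρ k).mesh ^ p * c) l (𝓝 0) := by
  have h := (hρ.rpow_const (p := p) (Or.inr hp.le)).mul_const c
  rwa [Real.zero_rpow hp.ne', zero_mul] at h

/-- Paths that are Hölder continuous of order more than `1/2` have zero quadratic variation. -/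
lemma tendsto_quadSum_of_holder {x : ℝ → ℝ} {C γ : ℝ} (hγ : 1 / 2 < γ)
    (h : ∀ s ∈ Set.Icc 0 T, ∀ t ∈ Set.Icc 0 T, s < t → |x t - x s| ≤ C * (t - s) ^ γ)
    {ρ : ℕ → TimePartition T} (hρ : Tendsto (fun k => (ρ k).mesh) atTop (𝓝 0)) :
    Tendsto (fun k => quadSum x (ρ k)) atTop (𝓝 0) := by
  refine squeeze_zero (fun k => quadSum_nonneg _ _) (fun k => ?_)
    (tendsto_mesh_rpow hρ (p := 2 * γ - 1) (by linarith) (T * C ^ 2))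
  calc quadSum x (ρ k)
      ≤ ∑ i ∈ Finset.range (ρ k).n, ((ρ k).t (i + 1) - (ρ k).t i) ^ (2 * γ) * C ^ 2 := by
        refine Finset.sum_le_sum fun i hi => ?_
        have hi := Finset.mem_range.1 hi
        have hlt := (ρ k).t_lt i hi
        have hle := h _ ((ρ k).t_mem_Icc hi.le) _ ((ρ k).t_mem_Icc hi) hlt
        rw [← sq_abs, mul_comm 2 γ, Real.rpow_mul (sub_pos.2 hlt).le, Real.rpow_two, ← mul_pow,
          mul_comm _ C]
        exact pow_le_pow_left₀ (abs_nonneg _) hle 2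
    _ ≤ (ρ k).mesh ^ (2 * γ - 1) * (T * C ^ 2) := by
        rw [← Finset.sum_mul, ← mul_assoc]
        gcongr
        exact sum_rpow_increments_le (ρ k) (by linarith)

namespace IsFractionalBrownianOn

variable {Ω : Type*} [MeasurableSpace Ω] {P : Measure Ω} {H : ℝ}
  {B : ℝ → Ω → ℝ}

lemma memLp_two (hB : IsFractionalBrownianOn B H T P) {t : ℝ} (ht : t ∈ Set.Icc 0 T) :
    MemLp (B t) 2 P :=
  (hB.gaussian.hasGaussianLaw_eval ⟨t, ht⟩).memLp_two

lemma variance_eq (hB : IsFractionalBrownianOn B H T P) (hH : 0 < H) {t : ℝ}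
    (ht : t ∈ Set.Icc 0 T) : Var[B t; P] = t ^ (2 * H) := by
  rw [← covariance_self (hB.memLp_two ht).aemeasurable, hB.covariance t ht t ht, sub_self,
    abs_zero, Real.zero_rpow (by positivity)]
  ring

variable [IsProbabilityMeasure P]

lemma hasLaw_sub (hB : IsFractionalBrownianOn B H T P) (hH : 0 < H) {s t : ℝ}
    (hs : s ∈ Set.Icc 0 T) (ht : t ∈ Set.Icc 0 T) :
    HasLaw (fun ω => B t ω - B s ω) (gaussianReal 0 (|t - s| ^ (2 * H)).toNNReal) P := by
  have hg : HasGaussianLaw (fun ω => B t ω - B s ω) P :=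
    hB.gaussian.hasGaussianLaw_fun_sub (s := ⟨t, ht⟩) (t := ⟨s, hs⟩)
  have hmean : ∫ ω, (B t ω - B s ω) ∂P = 0 := by
    rw [integral_sub ((hB.memLp_two ht).integrable one_le_two)
      ((hB.memLp_two hs).integrable one_le_two), hB.mean t ht, hB.mean s hs, sub_zero]
  have hvar : Var[fun ω => B t ω - B s ω; P] = |t - s| ^ (2 * H) := by
    have h := variance_sub (hB.memLp_two ht) (hB.memLp_two hs)
    rw [hB.variance_eq hH ht, hB.variance_eq hH hs, hB.covariance t ht s hs,
      abs_sub_comm s t] at h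
    change Var[B t - B s; P] = _
    rw [h]
    ring
  refine ⟨hg.aemeasurable, ?_⟩
  rw [hg.map_eq_gaussianReal, hmean, hvar]

/-- The covariance at time zero is `0`, so the centred variable `B 0` is almost surely constant. -/
lemma ae_zero (hB : IsFractionalBrownianOn B H T P) (hH : 0 < H) (hT : 0 ≤ T) :
    ∀ᵐ ω ∂P, B 0 ω = 0 := by
  have h0 : (0 : ℝ) ∈ Set.Icc 0 T := ⟨le_rfl, hT⟩
  have h := ae_eq_integral_of_variance_eq_zero (hB.memLp_two h0)
    (by rw [hB.variance_eq hH h0, Real.zero_rpow (by positivity)])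
  rwa [hB.mean 0 h0] at h

lemma integrable_quadSum (hB : IsFractionalBrownianOn B H T P) (hH : 0 < H)
    (π : TimePartition T) : Integrable (fun ω => quadSum (fun t => B t ω) π) P :=
  integrable_finsetSum _ fun _ hi =>
    integrable_pow_of_hasLaw_gaussianReal (hB.hasLaw_sub hH
      (π.t_mem_Icc (Finset.mem_range.1 hi).le) (π.t_mem_Icc (Finset.mem_range.1 hi))) 1

lemma integral_quadSum_le (hB : IsFractionalBrownianOn B H T P) (hH : 1 / 2 < H)
    (π : TimePartition T) :
    ∫ ω, quadSum (fun t => B t ω) π ∂P ≤ π.mesh ^ (2 * H - 1) * T := by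
  have hH0 : 0 < H := by linarith
  have hlaw : ∀ i ∈ Finset.range π.n, HasLaw (fun ω => B (π.t (i + 1)) ω - B (π.t i) ω)
      (gaussianReal 0 (|π.t (i + 1) - π.t i| ^ (2 * H)).toNNReal) P := fun i hi =>
    hB.hasLaw_sub hH0 (π.t_mem_Icc (Finset.mem_range.1 hi).le)
      (π.t_mem_Icc (Finset.mem_range.1 hi))
  simp only [quadSum]
  rw [integral_finsetSum _ fun i hi => integrable_pow_of_hasLaw_gaussianReal (hlaw i hi) 1]
  refine le_trans (le_of_eq (Finset.sum_congr rfl fun i hi => ?_))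
    (sum_rpow_increments_le π (p := 2 * H) (by linarith))
  have h := integral_pow_of_hasLaw_gaussianReal (hlaw i hi) 1
  rw [mul_one] at h
  have hpos := sub_pos.2 (π.t_lt i (Finset.mem_range.1 hi))
  rw [h, gaussianMoment_one, mul_one, pow_one, Real.coe_toNNReal _ (by positivity),
    abs_of_pos hpos]

/-- The dyadic increments of a fractional Brownian motion decay geometrically. -/
lemma ae_exists_dyadic_le (hB : IsFractionalBrownianOn B H T P) (hH : 0 < H) (hT : 0 < T)
    {γ : ℝ} (hγH : γ < H) :
    ∀ᵐ ω ∂P, ∃ K, 0 ≤ K ∧ ∀ n : ℕ, ∀ k < 2 ^ n,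
      |B (((k + 1 : ℕ) : ℝ) * (T * (1 / 2) ^ n)) ω - B ((k : ℝ) * (T * (1 / 2) ^ n)) ω| ≤
        K * ((1 / 2 : ℝ) ^ γ) ^ n := by
  set q : ℝ := (1 / 2 : ℝ) ^ γ with hq
  set p : ℝ := (1 / 2 : ℝ) ^ (2 * H) with hp
  have hq0 : 0 < q := by positivity
  have hp0 : 0 < p := by positivity
  have hpq : p / q ^ 2 < 1 := by
    rw [hp, hq, ← Real.rpow_two, ← Real.rpow_mul (by norm_num), ← Real.rpow_sub (by norm_num)]
    exact Real.rpow_lt_one (by norm_num) (by norm_num) (by linarith)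
  -- The moment order `2r` is taken so large that the gain `(p / q ^ 2) ^ r` per level beats the
  -- doubling of the number of dyadic increments; this is possible because `γ < H`.
  obtain ⟨r, hr⟩ := exists_pow_lt_of_lt_one (show (0 : ℝ) < 1 / 2 by norm_num) hpq
  have hr0 : r ≠ 0 := by
    rintro rfl
    norm_num at hr
  set D : ℕ → ℕ → Ω → ℝ := fun n k ω =>
    B (((k + 1 : ℕ) : ℝ) * (T * (1 / 2) ^ n)) ω - B ((k : ℝ) * (T * (1 / 2) ^ n)) ω with hD
  have hmem : ∀ n k : ℕ, k ≤ 2 ^ n → (k : ℝ) * (T * (1 / 2) ^ n) ∈ Set.Icc 0 T := by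
    intro n k hk
    refine ⟨by positivity, ?_⟩
    have hk' : (k : ℝ) ≤ 2 ^ n := by exact_mod_cast hk
    calc (k : ℝ) * (T * (1 / 2) ^ n) ≤ 2 ^ n * (T * (1 / 2) ^ n) := by gcongr
      _ = T * (2 * (1 / 2)) ^ n := by rw [mul_pow]; ring
      _ = T := by norm_num
  have hlaw : ∀ n, ∀ k < 2 ^ n,
      HasLaw (D n k) (gaussianReal 0 (T ^ (2 * H) * p ^ n).toNNReal) P := by
    intro n k hk
    have h := hB.hasLaw_sub hH (hmem n k hk.le) (hmem n (k + 1) hk)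
    have hval : |((k + 1 : ℕ) : ℝ) * (T * (1 / 2) ^ n) - (k : ℝ) * (T * (1 / 2) ^ n)| ^ (2 * H) =
        T ^ (2 * H) * p ^ n := by
      rw [hp, Real.rpow_pow_comm (by norm_num), ← Real.mul_rpow hT.le (by positivity)]
      congr 1
      rw [← sub_mul]
      push_cast
      rw [add_sub_cancel_left, one_mul, abs_of_pos (by positivity)]
    rwa [hval] at h
  set E : ℕ → Ω → ℝ := fun n ω => ∑ k ∈ Finset.range (2 ^ n), (D n k ω / q ^ n) ^ (2 * r) with hE
  have hE0 : ∀ n ω, 0 ≤ E n ω := fun n ω =>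
    Finset.sum_nonneg fun k _ => by rw [pow_mul]; positivity
  have hterm : ∀ n, ∀ k ∈ Finset.range (2 ^ n),
      Integrable (fun ω => (D n k ω / q ^ n) ^ (2 * r)) P := fun n k hk => by
    simp only [div_pow]
    exact (integrable_pow_of_hasLaw_gaussianReal (hlaw n k (Finset.mem_range.1 hk)) r).div_const _
  have hEi : ∀ n, Integrable (E n) P := fun n => integrable_finsetSum _ (hterm n)
  have hEint : ∀ n, ∫ ω, E n ω ∂P =
      (T ^ (2 * H)) ^ r * gaussianMoment r * (2 * (p / q ^ 2) ^ r) ^ n := by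
    intro n
    simp only [hE]
    rw [integral_finsetSum _ (hterm n)]
    have h1 : ∀ k ∈ Finset.range (2 ^ n), ∫ ω, (D n k ω / q ^ n) ^ (2 * r) ∂P =
        (T ^ (2 * H) * p ^ n) ^ r * gaussianMoment r / (q ^ n) ^ (2 * r) := fun k hk => by
      simp only [div_pow]
      rw [integral_div, integral_pow_of_hasLaw_gaussianReal (hlaw n k (Finset.mem_range.1 hk)),
        Real.coe_toNNReal _ (by positivity)]
    rw [Finset.sum_congr rfl h1, Finset.sum_const, Finset.card_range, nsmul_eq_mul]
    push_cast
    rw [mul_pow, mul_pow, div_pow, div_pow]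
    have e1 : (p ^ n) ^ r = (p ^ r) ^ n := by rw [← pow_mul, ← pow_mul, mul_comm]
    have e2 : (q ^ n) ^ (2 * r) = ((q ^ 2) ^ r) ^ n := by
      rw [← pow_mul, ← pow_mul, ← pow_mul]; congr 1; ring
    rw [e1, e2]
    ring
  have hsum : Summable fun n => ∫ ω, E n ω ∂P := by
    simp only [hEint]
    refine (summable_geometric_of_lt_one (by positivity) ?_).mul_left _
    linarith
  -- Summable expectations make the sum over all levels almost surely finite, so it bounds every
  -- normalized dyadic increment at once.
  have hfin : ∫⁻ ω, ∑' n, ENNReal.ofReal (E n ω) ∂P ≠ ⊤ := by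
    rw [lintegral_tsum fun n => (hEi n).aemeasurable.ennreal_ofReal]
    have h : ∀ n, ∫⁻ ω, ENNReal.ofReal (E n ω) ∂P = ENNReal.ofReal (∫ ω, E n ω ∂P) := fun n =>
      (ofReal_integral_eq_lintegral_ofReal (hEi n) (ae_of_all _ (hE0 n))).symm
    simp only [h]
    exact hsum.tsum_ofReal_ne_top
  have hae := ae_lt_top' (AEMeasurable.tsum fun n =>
    (hEi n).aemeasurable.ennreal_ofReal) hfin
  filter_upwards [hae] with ω hω
  set S : ℝ := (∑' n, ENNReal.ofReal (E n ω)).toReal with hS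
  have hS0 : 0 ≤ S := ENNReal.toReal_nonneg
  -- From `y ^ (2 * r) ≤ S` follows `|y| ≤ 1 + S`: otherwise `|y| > 1`, and then `|y| ≤ y ^ (2 * r)
  -- ≤ S`.
  refine ⟨1 + S, by positivity, fun n k hk => ?_⟩
  have h1 : E n ω ≤ S := by
    rw [hS, ← ENNReal.ofReal_le_iff_le_toReal hω.ne]
    exact ENNReal.le_tsum n
  have h2 : (D n k ω / q ^ n) ^ (2 * r) ≤ S := by
    refine le_trans ?_ h1
    exact Finset.single_le_sum (f := fun k => (D n k ω / q ^ n) ^ (2 * r))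
      (fun k _ => by rw [pow_mul]; positivity) (Finset.mem_range.2 hk)
  have h3 : |D n k ω / q ^ n| ≤ 1 + S := by
    by_contra hc
    push Not at hc
    have h4 : |D n k ω / q ^ n| ≤ |D n k ω / q ^ n| ^ (2 * r) :=
      le_self_pow₀ (by linarith) (by omega)
    rw [pow_mul, sq_abs, ← pow_mul] at h4
    linarith
  rwa [abs_div, abs_of_pos (pow_pos hq0 n), div_le_iff₀ (pow_pos hq0 n)] at h3

/-- The realized quadratic variations of a fractional Brownian motion with Hurst parameter more
than `1/2` vanish in the limit, almost surely and simultaneously for all sequences of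
partitions. -/
theorem ae_tendsto_quadSum (hB : IsFractionalBrownianOn B H T P) (hH : 1 / 2 < H) (hT : 0 < T) :
    ∀ᵐ ω ∂P, ∀ ρ : ℕ → TimePartition T, Tendsto (fun k => (ρ k).mesh) atTop (𝓝 0) →
      Tendsto (fun k => quadSum (fun t => B t ω) (ρ k)) atTop (𝓝 0) := by
  -- The exponent is the midpoint of `1/2` and `H`: below `H` for chaining, above `1/2` for zero
  -- quadratic variation.
  filter_upwards [hB.cont, hB.ae_exists_dyadic_le (by linarith) hT
    (γ := (H + 1 / 2) / 2) (by linarith)] with ω hc ⟨K, hK, hω⟩ ρ hρ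
  obtain ⟨C, -, hC⟩ := exists_holder_of_dyadic (x := fun t => B t ω) hT hc hK
    (γ := (H + 1 / 2) / 2) (by linarith) hω
  exact tendsto_quadSum_of_holder (by linarith) hC hρ

end IsFractionalBrownianOn

end FractionalBrownianMotion

/-! ### Quadratic variation of the mixed process -/

section Mixed

variable {Ω : Type*} [MeasurableSpace Ω] {P : Measure Ω} [IsProbabilityMeasure P] {T H : ℝ}
  {W B : ℝ → Ω → ℝ}

lemma IsBrownianOn.tendsto_measure_quadSum (hW : IsBrownianOn W T P) {δ : ℝ} (hδ : 0 < δ) :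
    Tendsto (fun π : TimePartition T => P {ω | δ ≤ |quadSum (fun t => W t ω) π - T|})
      (TimePartition.meshToZero T) (𝓝 0) := by
  have hlim : Tendsto (fun π : TimePartition T =>
      ENNReal.ofReal (gaussianMoment 2 * T * π.mesh / δ ^ 2)) (TimePartition.meshToZero T)
      (𝓝 0) := by
    have h := ((tendsto_comap (f := TimePartition.mesh (T := T)) (x := 𝓝 0)).const_mul
      (gaussianMoment 2 * T)).div_const (δ ^ 2)
    rw [mul_zero, zero_div] at h
    simpa [TimePartition.meshToZero] using ENNReal.tendsto_ofReal h
  refine tendsto_of_tendsto_of_tendsto_of_le_of_le tendsto_const_nhds hlim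
    (fun _ => zero_le) fun π => ?_
  have hsub : {ω | δ ≤ |quadSum (fun t => W t ω) π - T|} ⊆
      {ω | δ ^ 2 ≤ (quadSum (fun t => W t ω) π - T) ^ 2} := fun ω hω => by
    have h := pow_le_pow_left₀ hδ.le hω 2
    rwa [sq_abs] at h
  have hmarkov := mul_meas_ge_le_integral_of_nonneg (μ := P)
    (f := fun ω => (quadSum (fun t => W t ω) π - T) ^ 2) (ae_of_all _ fun _ => sq_nonneg _)
    ((hW.memLp_quadSum π).sub (memLp_const T)).integrable_sq (δ ^ 2)
  refine (measure_mono hsub).trans ?_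
  rw [← ofReal_measureReal]
  refine ENNReal.ofReal_le_ofReal ?_
  rw [le_div_iff₀ (by positivity), mul_comm]
  exact hmarkov.trans (hW.integral_quadSum_sub_sq_le π)

lemma IsFractionalBrownianOn.tendsto_measure_quadSum (hB : IsFractionalBrownianOn B H T P)
    (hH : 1 / 2 < H) {δ : ℝ} (hδ : 0 < δ) :
    Tendsto (fun π : TimePartition T => P {ω | δ ≤ quadSum (fun t => B t ω) π})
      (TimePartition.meshToZero T) (𝓝 0) := by
  have hlim : Tendsto (fun π : TimePartition T =>
      ENNReal.ofReal (π.mesh ^ (2 * H - 1) * T / δ)) (TimePartition.meshToZero T) (𝓝 0) := by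
    have h := (tendsto_mesh_rpow (ρ := fun π : TimePartition T => π)
      (tendsto_comap (f := TimePartition.mesh (T := T)) (x := 𝓝 0))
      (p := 2 * H - 1) (by linarith) T).div_const δ
    rw [zero_div] at h
    simpa [TimePartition.meshToZero] using ENNReal.tendsto_ofReal h
  refine tendsto_of_tendsto_of_tendsto_of_le_of_le tendsto_const_nhds hlim
    (fun _ => zero_le) fun π => ?_
  have hmarkov := mul_meas_ge_le_integral_of_nonneg (μ := P)
    (ae_of_all _ fun ω => quadSum_nonneg (fun t => B t ω) π)
    (hB.integrable_quadSum (by linarith) π) δ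
  simp only
  rw [← ofReal_measureReal]
  refine ENNReal.ofReal_le_ofReal ?_
  rw [le_div_iff₀ (by positivity), mul_comm]
  exact hmarkov.trans (hB.integral_quadSum_le hH π)

/-- The sum of a Brownian motion and a fractional Brownian motion with Hurst parameter more than
`1/2` has quadratic variation `T` on `[0, T]`. -/
theorem isQuadraticVariation_add (hT : 0 < T) (hH : 1 / 2 < H) (hW : IsBrownianOn W T P)
    (hB : IsFractionalBrownianOn B H T P) :
    IsQuadraticVariation (fun t ω => W t ω + B t ω) T P fun _ => T := by
  rw [IsQuadraticVariation, tendstoInMeasure_iff_dist]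
  intro ε hε
  -- This is the total error when the variation of `W` is within `δ` of `T` and that of `B` is below
  -- `δ`; `T + 1` bounds the former because `δ < 1`.
  have hcont : Tendsto (fun δ : ℝ => δ + (2 * √((T + 1) * δ) + δ)) (𝓝[>] 0) (𝓝 0) := by
    have h : Continuous fun δ : ℝ => δ + (2 * √((T + 1) * δ) + δ) := by fun_prop
    simpa using (h.tendsto 0).mono_left nhdsWithin_le_nhds
  obtain ⟨δ, hδε, hδ0, hδ1⟩ := ((hcont.eventually (gt_mem_nhds hε)).and
    (Ioo_mem_nhdsGT (zero_lt_one' ℝ))).exists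
  have hlim := (hW.tendsto_measure_quadSum hδ0).add (hB.tendsto_measure_quadSum hH hδ0)
  rw [add_zero] at hlim
  refine tendsto_of_tendsto_of_tendsto_of_le_of_le tendsto_const_nhds hlim
    (fun _ => zero_le) fun π => (measure_mono fun ω hω => ?_).trans (measure_union_le _ _)
  by_contra hc
  simp only [Set.mem_union, Set.mem_ofPred_eq, not_or, not_le] at hc
  obtain ⟨h1, h2⟩ := hc
  have hω' : ε ≤ |quadSum (fun t => W t ω + B t ω) π - T| := hω
  have h3 := abs_quadSum_add_sub_le' (fun t => W t ω) (fun t => B t ω) π T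
  have h4 : quadSum (fun t => W t ω) π ≤ T + 1 := by linarith [(abs_lt.1 h1).2]
  have h5 : √(quadSum (fun t => W t ω) π * quadSum (fun t => B t ω) π) ≤ √((T + 1) * δ) := by
    refine Real.sqrt_le_sqrt (mul_le_mul h4 h2.le (quadSum_nonneg _ _) (by linarith))
  linarith

theorem ae_tendsto_quadSum_add (hT : 0 < T) (hH : 1 / 2 < H) (hW : IsBrownianOn W T P)
    (hB : IsFractionalBrownianOn B H T P) {ρ : ℕ → TimePartition T}
    (hρ : TimePartition.IsNestedSeq ρ) :
    ∀ᵐ ω ∂P, Tendsto (fun k => quadSum (fun t => W t ω + B t ω) (ρ k)) atTop (𝓝 T) := by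
  filter_upwards [hW.ae_tendsto_quadSum hρ, hB.ae_tendsto_quadSum hH hT] with ω h1 h2
  have h2 := h2 ρ hρ.mesh_tendsto
  rw [tendsto_iff_dist_tendsto_zero] at h1 ⊢
  have h3 := tendsto_iff_dist_tendsto_zero.2 h1
  have h4 := h1.add ((((h3.mul h2).sqrt).const_mul 2).add h2)
  simp only [mul_zero, Real.sqrt_zero, add_zero] at h4
  exact squeeze_zero (fun _ => dist_nonneg)
    (fun k => abs_quadSum_add_sub_le' (fun t => W t ω) (fun t => B t ω) (ρ k) T) h4

end Mixed

end MixedFBM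

end

theorem lemma2p2 {Ω : Type*} [MeasurableSpace Ω] (P : Measure Ω) [IsProbabilityMeasure P]
    (T H : ℝ) (hT : 0 < T) (hH : H ∈ Set.Ioo (1 / 2 : ℝ) 1)
    (W B X : ℝ → Ω → ℝ)
    (hW : MixedFBM.IsBrownianOn W T P)
    (hB : MixedFBM.IsFractionalBrownianOn B H T P)
    (hWB : IndepFun (fun ω (t : Set.Icc (0 : ℝ) T) => W t ω)
      (fun ω (t : Set.Icc (0 : ℝ) T) => B t ω) P)
    (hX : ∀ t ∈ Set.Icc (0 : ℝ) T, ∀ ω, X t ω = W t ω + B t ω) :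
    ∃ V : Ω → ℝ, MixedFBM.IsQuadraticVariation X T P V ∧
      ∃ J : ℝ → Ω → ℂ,
        (∀ ρ : ℕ → MixedFBM.TimePartition T, MixedFBM.TimePartition.IsNestedSeq ρ →
          ∀ᵐ ω ∂P,
            Tendsto (fun k => MixedFBM.quadSum (fun t => X t ω) (ρ k)) atTop (𝓝 (V ω)) ∧
            ∀ lam : ℝ, Tendsto (fun k => MixedFBM.iteratedSum (fun t => X t ω) lam (ρ k))
              atTop (𝓝 (J lam ω))) ∧
        ∀ᵐ ω ∂P, ∀ lam : ℝ,
          MixedFBM.periodogram (fun t => X t ω) T lam = V ω + 2 * (J lam ω).re := by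
  have hXeq : ∀ ω, Set.EqOn (fun t => X t ω) (fun t => W t ω + B t ω) (Set.Icc 0 T) :=
    fun ω t ht => hX t ht ω
  have hQ : ∀ (π : MixedFBM.TimePartition T) ω, MixedFBM.quadSum (fun t => X t ω) π =
      MixedFBM.quadSum (fun t => W t ω + B t ω) π :=
    fun π ω => MixedFBM.quadSum_congr (hXeq ω) π
  have hgood : ∀ᵐ ω ∂P, ContinuousOn (fun t => X t ω) (Set.Icc 0 T) ∧ X 0 ω = 0 := by
    filter_upwards [hW.cont, hB.cont, hW.zero, hB.ae_zero (by linarith [hH.1]) hT.le]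
      with ω h1 h2 h3 h4
    refine ⟨(h1.add h2).congr (hXeq ω), ?_⟩
    rw [hX 0 ⟨le_rfl, hT.le⟩, h3, h4, add_zero]
  -- `J` is fixed path by path before any sequence of partitions, and for all `λ` together, so the
  -- null set depends only on `ρ`. Off the good event the requirement is void and `J` is set to `0`.
  have hJ : ∀ ω, ∃ J : ℝ → ℂ, (ContinuousOn (fun t => X t ω) (Set.Icc 0 T) ∧ X 0 ω = 0) →
      (∀ lam, MixedFBM.periodogram (fun t => X t ω) T lam = T + 2 * (J lam).re) ∧
      ∀ ρ : ℕ → MixedFBM.TimePartition T, Tendsto (fun k => (ρ k).mesh) atTop (𝓝 0) →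
        Tendsto (fun k => MixedFBM.quadSum (fun t => X t ω) (ρ k)) atTop (𝓝 T) →
        ∀ lam, Tendsto (fun k => MixedFBM.iteratedSum (fun t => X t ω) lam (ρ k)) atTop
          (𝓝 (J lam)) := by
    intro ω
    by_cases h : ContinuousOn (fun t => X t ω) (Set.Icc 0 T) ∧ X 0 ω = 0
    · obtain ⟨J, hJ⟩ := MixedFBM.exists_tendsto_iteratedSum h.1 h.2 hT.le T
      exact ⟨J, fun _ => hJ⟩
    · exact ⟨0, fun h' => absurd h' h⟩
  choose J hJ using hJ
  refine ⟨fun _ => T, ?_, fun lam ω => J ω lam, fun ρ hρ => ?_, ?_⟩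
  · have h := MixedFBM.isQuadraticVariation_add hT hH.1 hW hB
    simp only [MixedFBM.IsQuadraticVariation, hQ] at h ⊢
    exact h
  · filter_upwards [hgood, MixedFBM.ae_tendsto_quadSum_add hT hH.1 hW hB hρ] with ω hω h
    simp only [← hQ] at h
    exact ⟨h, (hJ ω hω).2 ρ hρ.mesh_tendsto h⟩
  · filter_upwards [hgood] with ω hω
    exact (hJ ω hω).1
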